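/- Let $\mathfrak{A}$ be a nonzero unital separable complex C$^*$-algebra with unit $I$, let $\mathfrak{A}^{-1}$ be the group of invertible elements of $\mathfrak{A}$ with the norm topology, and let $\mathfrak{A}^{-1}_0$ be the connected component of $I$ in $\mathfrak{A}^{-1}$. For $A\in\mathfrak{A}$ let $\sigma(A)$ denote the spectrum of $A$ in $\mathfrak{A}$. Two projections $P,Q\in\mathfrak{A}$ are called Murray–von Neumann equivalent if there is $V\in\mathfrak{A}$ with $V^*V=P$ and $VV^*=Q$. A nonzero projection $P\in\mathfrak{A}$ is called properly infinite if there are mutually orthogonal projections $E,F\le P$ in $\mathfrak{A}$, each of which is Murray–von Neumann equivalent to $P$. Suppose that 1. $\mathfrak{A}$ has property weak (FN): every normal $N\in\mathfrak{A}$ such that $\lambda I-N\in\mathfrak{A}^{-1}_0$ for all $\lambda\in\mathbb{C}\setminus\sigma(N)$ is a norm limit of normal elements of $\mathfrak{A}$ with finite spectrum; 2. every nonzero projection in $\mathfrak{A}$ is properly infinite; and 3. any two nonzero projections in $\mathfrak{A}$ are Murray–von Neumann equivalent. Let $N\in\mathfrak{A}$ be normal. Then $N$ is a norm limit of nilpotent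 elements of $\mathfrak{A}$ if and only if $0\in\sigma(N)$, $\sigma(N)$ is connected, and $\lambda I-N\in\mathfrak{A}^{-1}_0$ for all $\lambda\in\mathbb{C}\setminus\sigma(N)$. -/

import Mathlib

/-- Murray–von Neumann equivalence of `p` and `q` in a star ring `A`: there is `v` in `A` with
`v⋆ v = p` and `v v⋆ = q`. (For projections `p`, `q` such a `v` is automatically a partial
isometry.) -/
def MurrayVonNeumannEquiv {A : Type*} [Mul A] [Star A] (p q : A) : Prop :=
  ∃ v : A, star v * v = p ∧ v * star v = q

/-- A projection `p` is properly infinite if it is nonzero and has two mutually orthogonal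
subprojections `e ≤ p` and `f ≤ p`, each Murray–von Neumann equivalent to `p`. For projections,
`e ≤ p` means `p e = e`. -/
def IsProperlyInfinite {A : Type*} [CStarAlgebra A] (p : A) : Prop :=
  IsStarProjection p ∧ p ≠ 0 ∧
    ∃ e f : A, IsStarProjection e ∧ IsStarProjection f ∧
      p * e = e ∧ p * f = f ∧ e * f = 0 ∧
      MurrayVonNeumannEquiv e p ∧ MurrayVonNeumannEquiv f p

/-- The connected component of the identity in the group of invertible elements of `A`, as a
subset of `A`. (The topology of the unit group of a complete normed ring is the norm topology.) -/
def identityComponent (A : Type*) [CStarAlgebra A] : Set A :=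
  {a : A | ∃ u : Aˣ, u ∈ connectedComponent (1 : Aˣ) ∧ (u : A) = a}

/-- The weak finite normal property, weak (FN): every normal `N` such that `z 1 - N` is in the
identity component of the invertibles for all `z` outside the spectrum of `N` is a norm limit of
normal elements with finite spectrum. -/
def WeakFN (A : Type*) [CStarAlgebra A] : Prop :=
  ∀ N : A, IsStarNormal N →
    (∀ z : ℂ, z ∉ spectrum ℂ N → algebraMap ℂ A z - N ∈ identityComponent A) →
    N ∈ closure {M : A | IsStarNormal M ∧ (spectrum ℂ M).Finite}

/-!
The easy direction rests on a Cauchy integral over the plane. If normal elements `N` are close to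
nilpotents `Q`, and `f` is a compactly supported smooth function that vanishes near `0` and is
locally constant near the spectrum of `N`, then the integral of `dbar f w • resolvent Q w` vanishes
(integrate by parts in the expansion of the resolvent into negative powers of `w`), so that the same
integral for `N` is small. By the functional calculus the latter dominates the scalar Cauchy
integrals of `dbar f`, which are nonzero where `f = 1`. Hence `N` keeps a distance to the nilpotents
which depends only on `f` and on the distance of the support of `dbar f` to the spectrum
(`exists_pos_le_norm_sub_of_isNilpotent`). With `f = 1` near one piece of a separation of the
spectrum this gives connectedness. The condition on the identity component holds because it holds
for nilpotents and the component is closed.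

For the converse, all nonzero projections are equivalent to `1`, and `1` splits into two such
projections, so `A` contains Cuntz families of all finite sizes, and with them unital matrix
subalgebras. Moreover, normal elements with finite spectra are classified up to unitary equivalence
by their spectra, and approximately so by their spectra up to Hausdorff distance
(`IsStarNormal.exists_unitary_norm_sub_le`). By weak (FN) it therefore suffices to find, for each
connected compact `K` containing `0`, a normal element with finite spectrum which is Hausdorff close
to `K` and which is norm close to a nilpotent. It is `p(H)`, where `p` is a polynomial curve with
`p(0) = 0` that traces `K`, and `H` is a positive element with spectrum `ε`-dense in `[0, 1]` that is
close to a nilpotent `Q`; then `p(Q)` is nilpotent and close to `p(H)`.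

The element `H` comes from the strictly upper triangular part of a Hilbert matrix, whose skew part
is bounded while its self-adjoint part grows logarithmically in the size
(`exists_isNilpotent_norm_sub_le`). Nothing has to be computed about its spectrum: a gap in `[0, 1]`
below the spectral value `1` is excluded by the Cauchy integral argument, with `f` a radial cutoff
function about `1` (`exists_pos_forall_exists_mem_spectrum`).
-/

/-! ### Cuntz families and unital matrix subalgebras -/

/-- A finite family of isometries `v i` with mutually orthogonal ranges whose range projections
sum to `1`, that is, a unital representation of the Cuntz algebra on the index set. -/
structure IsCuntzFamily {ι A : Type*} [Fintype ι] [DecidableEq ι] [Ring A] [StarRing A]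
    (v : ι → A) : Prop where
  star_mul_eq : ∀ i j, star (v i) * v j = if i = j then 1 else 0
  sum_mul_star : ∑ i, v i * star (v i) = 1

namespace IsCuntzFamily

section Ring

variable {ι A : Type*} [Fintype ι] [DecidableEq ι] [Ring A] [StarRing A]

/-- Substituting Cuntz families into the members of a Cuntz family gives a Cuntz family. -/
lemma sigma {κ : ι → Type*} [∀ i, Fintype (κ i)] [∀ i, DecidableEq (κ i)] {w : ι → A}
    (hw : IsCuntzFamily w) {x : ∀ i, κ i → A} (hx : ∀ i, IsCuntzFamily (x i)) :
    IsCuntzFamily (fun p : Σ i, κ i => w p.1 * x p.1 p.2) where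
  star_mul_eq := by
    rintro ⟨i, a⟩ ⟨j, b⟩
    have h : star (w i * x i a) * (w j * x j b) = star (x i a) * (star (w i) * w j) * x j b := by
      simp only [star_mul, mul_assoc]
    simp only [h, hw.star_mul_eq]
    by_cases hij : i = j
    · subst hij
      simp [(hx i).star_mul_eq]
    · simp [hij]
  sum_mul_star := by
    have h (i : ι) (a : κ i) : w i * x i a * star (w i * x i a) =
        w i * (x i a * star (x i a)) * star (w i) := by
      simp only [star_mul, mul_assoc]
    simp only [Fintype.sum_sigma, h, ← Finset.sum_mul, ← Finset.mul_sum, (hx _).sum_mul_star,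
      mul_one, hw.sum_mul_star]

lemma comp_equiv {κ : Type*} [Fintype κ] [DecidableEq κ] {v : ι → A} (hv : IsCuntzFamily v)
    (e : κ ≃ ι) : IsCuntzFamily (v ∘ e) where
  star_mul_eq i j := by simp [hv.star_mul_eq]
  sum_mul_star := by
    rw [← hv.sum_mul_star]
    exact Equiv.sum_comp e (fun i => v i * star (v i))

/-- Two isometries whose range projections sum to `1` have orthogonal ranges. -/
lemma star_mul_eq_zero_of_add_eq_one {s t : A} (hs : star s * s = 1) (ht : star t * t = 1)
    (hst : s * star s + t * star t = 1) : star s * t = 0 := by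
  have h : star s * (s * star s + t * star t) * t = star s * t + star s * t := by
    have e : star s * (s * star s + t * star t) * t =
        (star s * s) * (star s * t) + (star s * t) * (star t * t) := by noncomm_ring
    rw [e, hs, ht, one_mul, mul_one]
  rw [hst, mul_one] at h
  exact left_eq_add.mp h

/-- Two isometries whose range projections sum to `1` generate Cuntz families of every positive
size. -/
lemma exists_of_pair {s t : A} (hs : star s * s = 1) (ht : star t * t = 1)
    (hst : s * star s + t * star t = 1) (κ : Type*) [Fintype κ] [DecidableEq κ] [Nonempty κ] :
    ∃ v : κ → A, IsCuntzFamily v := by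
  have h0 := star_mul_eq_zero_of_add_eq_one hs ht hst
  have h0' : star t * s = 0 := by simpa using congrArg star h0
  have key : ∀ n : ℕ, ∃ v : Fin (n + 1) → A, IsCuntzFamily v := by
    intro n
    induction n with
    | zero => exact ⟨fun _ => 1, ⟨fun i j => by simp [Subsingleton.elim (α := Fin 1) i j], by simp⟩⟩
    | succ n ih =>
      obtain ⟨v, hv⟩ := ih
      refine ⟨Fin.cons s fun i => t * v i, ⟨?_, ?_⟩⟩
      · intro i j
        refine Fin.cases ?_ (fun i => ?_) i <;> refine Fin.cases ?_ (fun j => ?_) j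
        · simp [hs]
        · have : star s * (t * v j) = 0 := by rw [← mul_assoc, h0, zero_mul]
          simp [this, (Fin.succ_ne_zero _).symm]
        · have : star (v i) * star t * s = 0 := by rw [mul_assoc, h0', mul_zero]
          simp [this]
        · have : star (v i) * star t * (t * v j) = star (v i) * v j := by
            rw [mul_assoc, ← mul_assoc (star t), ht, one_mul]
          simp [this, hv.star_mul_eq]
      · have (i : Fin (n + 1)) : t * v i * star (t * v i) = t * (v i * star (v i)) * star t := by
          simp only [star_mul, mul_assoc]
        rw [Fin.sum_univ_succ]
        simp only [Fin.cons_zero, Fin.cons_succ, this, ← Finset.sum_mul, ← Finset.mul_sum,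
          hv.sum_mul_star, mul_one, hst]
  obtain ⟨n, hn⟩ := Nat.exists_eq_succ_of_ne_zero (Fintype.card_ne_zero (α := κ))
  obtain ⟨v, hv⟩ := key n
  exact ⟨_, hv.comp_equiv ((Fintype.equivFin κ).trans (finCongr hn))⟩

/-- Any two Cuntz families on the same index set are intertwined by a unitary. -/
lemma exists_unitary {v w : ι → A} (hv : IsCuntzFamily v) (hw : IsCuntzFamily w) :
    ∃ u : A, star u * u = 1 ∧ u * star u = 1 ∧ ∀ i, u * w i = v i := by
  have key {v w : ι → A} (hv : IsCuntzFamily v) (hw : IsCuntzFamily w) :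
      star (∑ i, v i * star (w i)) * (∑ i, v i * star (w i)) = 1 := by
    have h (i j : ι) : w i * star (v i) * (v j * star (w j)) =
        if i = j then w i * star (w j) else 0 := by
      rw [mul_assoc, ← mul_assoc (star (v i)), hv.star_mul_eq]
      split_ifs <;> simp
    simp [star_sum, Finset.sum_mul_sum, h, hw.sum_mul_star]
  refine ⟨∑ i, v i * star (w i), key hv hw, ?_, fun i => ?_⟩
  · have := key hw hv
    simpa [star_sum] using this
  · simp [Finset.sum_mul, mul_assoc, hw.star_mul_eq]

end Ring

section Algebra

variable {ι A : Type*} [Fintype ι] [DecidableEq ι] [Ring A] [StarRing A] [Algebra ℂ A]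
  [StarModule ℂ A]

/-- The unital star homomorphism of a matrix algebra that sends the matrix unit `(i, j)` to
`v i * star (v j)`, for a Cuntz family `v`. -/
noncomputable def matrixHom {v : ι → A} (hv : IsCuntzFamily v) : Matrix ι ι ℂ →⋆ₐ[ℂ] A where
  toFun a := ∑ i, ∑ j, a i j • (v i * star (v j))
  map_one' := by
    simp [Matrix.one_apply, ite_smul, hv.sum_mul_star]
  map_mul' a b := by
    have h (i j k l : ι) : v i * star (v j) * (v k * star (v l)) =
        if j = k then v i * star (v l) else 0 := by
      rw [mul_assoc, ← mul_assoc (star (v j)), hv.star_mul_eq]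
      split_ifs <;> simp
    simp only [Finset.sum_mul, Finset.mul_sum, smul_mul_smul_comm, h, Matrix.mul_apply,
      Finset.sum_smul, smul_ite, smul_zero]
    rw [Finset.sum_comm_cycle]
    refine Finset.sum_congr rfl fun k _ => ?_
    rw [Finset.sum_comm]
    simp
  map_zero' := by simp
  map_add' a b := by simp [add_smul, Finset.sum_add_distrib]
  commutes' c := by
    simp [Matrix.algebraMap_matrix_apply, ite_smul, ← Finset.smul_sum, hv.sum_mul_star,
      Algebra.algebraMap_eq_smul_one]
  map_star' a := by
    simp only [Matrix.star_apply]
    rw [Finset.sum_comm]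
    simp [star_sum, star_smul]

lemma matrixHom_diagonal {v : ι → A} (hv : IsCuntzFamily v) (c : ι → ℂ) :
    hv.matrixHom (Matrix.diagonal c) = ∑ i, c i • (v i * star (v i)) := by
  simp [matrixHom, Matrix.diagonal_apply, ite_smul]

end Algebra

section CStar

open scoped Matrix.Norms.L2Operator

variable {ι A : Type*} [Fintype ι] [DecidableEq ι] [CStarAlgebra A] {v : ι → A}

lemma norm_matrixHom_le (hv : IsCuntzFamily v) (a : Matrix ι ι ℂ) : ‖hv.matrixHom a‖ ≤ ‖a‖ :=
  NonUnitalStarAlgHom.norm_apply_le hv.matrixHom a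

lemma norm_sum_smul_le (hv : IsCuntzFamily v) {c : ι → ℂ} {r : ℝ} (hr : 0 ≤ r)
    (hc : ∀ i, ‖c i‖ ≤ r) : ‖∑ i, c i • (v i * star (v i))‖ ≤ r := by
  rw [← hv.matrixHom_diagonal]
  refine (hv.norm_matrixHom_le _).trans ?_
  rw [Matrix.l2_opNorm_diagonal]
  exact (pi_norm_le_iff_of_nonneg hr).mpr hc

lemma matrixHom_injective [Nontrivial A] (hv : IsCuntzFamily v) :
    Function.Injective hv.matrixHom := by
  rw [injective_iff_map_eq_zero]
  intro a ha
  ext i j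
  have h : star (v i) * hv.matrixHom a * v j = a i j • (1 : A) := by
    have e (k l : ι) : star (v i) * (v k * star (v l)) * v j =
        if i = k then if l = j then 1 else 0 else 0 := by
      have : star (v i) * (v k * star (v l)) * v j = (star (v i) * v k) * (star (v l) * v j) := by
        simp only [mul_assoc]
      rw [this, hv.star_mul_eq, hv.star_mul_eq]
      split_ifs <;> simp
    simp [matrixHom, Finset.mul_sum, Finset.sum_mul, e]
  rw [ha, mul_zero, zero_mul] at h
  simpa using h.symm

lemma norm_matrixHom [Nontrivial A] (hv : IsCuntzFamily v) (a : Matrix ι ι ℂ) :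
    ‖hv.matrixHom a‖ = ‖a‖ :=
  NonUnitalStarAlgHom.norm_map hv.matrixHom hv.matrixHom_injective a

end CStar

end IsCuntzFamily

/-! ### Normal elements with finite spectrum -/

section FiniteSpectrum

variable {A : Type*} [CStarAlgebra A]

/-- If every nonzero projection is equivalent to `1`, then a normal element with finite spectrum
is diagonal with respect to a Cuntz family indexed by its spectrum. -/
lemma IsStarNormal.exists_isCuntzFamily_of_finite_spectrum
    (heq : ∀ p : A, IsStarProjection p → p ≠ 0 → MurrayVonNeumannEquiv 1 p)
    {M : A} (hM : IsStarNormal M) [Fintype (spectrum ℂ M)] :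
    ∃ w : spectrum ℂ M → A, IsCuntzFamily w ∧
      M = ∑ z : spectrum ℂ M, (z : ℂ) • (w z * star (w z)) := by
  classical
  have hfin : (spectrum ℂ M).Finite := Set.toFinite _
  have hcont (f : ℂ → ℂ) : ContinuousOn f (spectrum ℂ M) := hfin.continuousOn f
  let χ : spectrum ℂ M → ℂ → ℂ := fun z x => if x = z then 1 else 0
  have hmul (z y : spectrum ℂ M) : cfc (χ z) M * cfc (χ y) M = if z = y then cfc (χ z) M else 0 := by
    rw [← cfc_mul _ _ M (hcont _) (hcont _)]
    split_ifs with h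
    · subst h
      congr 1
      ext x
      simp [χ]
    · rw [← cfc_zero ℂ M]
      congr 1
      ext x
      have h' : (z : ℂ) ≠ y := fun e => h (Subtype.ext e)
      by_cases hx : x = z
      · simp [χ, hx, h']
      · simp [χ, hx]
  have hstar (z : spectrum ℂ M) : star (cfc (χ z) M) = cfc (χ z) M := by
    rw [← cfc_star]
    congr 1
    ext x
    simp only [χ]
    split_ifs <;> simp
  have hproj (z : spectrum ℂ M) : IsStarProjection (cfc (χ z) M) :=
    ⟨(hmul z z).trans (if_pos rfl), hstar z⟩
  have hne (z : spectrum ℂ M) : cfc (χ z) M ≠ 0 := by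
    intro h
    have h1 : χ z z ∈ spectrum ℂ (cfc (χ z) M) := by
      rw [cfc_map_spectrum _ _ hM (hcont _)]
      exact ⟨z, z.2, rfl⟩
    have hA : Nontrivial A := by
      by_contra hA
      rw [not_nontrivial_iff_subsingleton] at hA
      simpa using (spectrum.of_subsingleton M).subset z.2
    rw [h, spectrum.zero_eq] at h1
    simp [χ] at h1
  choose w hw1 hw2 using fun z => heq _ (hproj z) (hne z)
  have hsum (c : ℂ → ℂ) : ∑ z : spectrum ℂ M, c z • (w z * star (w z)) = cfc c M := by
    simp only [hw2]
    have h (z : spectrum ℂ M) : c z • cfc (χ z) M = cfc (fun x => c z • χ z x) M :=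
      (cfc_smul _ _ M (hcont _)).symm
    simp only [h]
    rw [← cfc_sum_univ _ _ (fun _ => hcont _)]
    refine cfc_congr fun x hx => ?_
    simp only [Finset.sum_apply, χ, smul_eq_mul, mul_ite, mul_one, mul_zero]
    rw [Finset.sum_eq_single ⟨x, hx⟩]
    · simp
    · intro z _ hz
      rw [if_neg]
      rintro rfl
      exact hz rfl
    · simp
  refine ⟨w, ⟨fun i j => ?_, ?_⟩, ?_⟩
  · split_ifs with h
    · rw [← h, hw1]
    · have e : star (w i) * w j = star (w i) * ((w i * star (w i)) * (w j * star (w j))) * w j := by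
        have : star (w i) * ((w i * star (w i)) * (w j * star (w j))) * w j =
          (star (w i) * w i) * (star (w i) * w j) * (star (w j) * w j) := by noncomm_ring
        rw [this, hw1, hw1, one_mul, mul_one]
      rw [e, hw2, hw2, hmul, if_neg h, mul_zero, zero_mul]
  · simpa [cfc_const_one] using hsum fun _ => 1
  · conv_lhs => rw [← cfc_id ℂ M]
    exact (hsum id).symm

/-- If `A` contains two isometries with complementary ranges and every nonzero projection is
equivalent to `1`, then two normal elements with finite spectra at Hausdorff distance at most `r`
are, up to a unitary conjugation, at distance at most `r`. Both elements are diagonalised by Cuntz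
families indexed by the pairs of spectral values at distance at most `r`. -/
lemma IsStarNormal.exists_unitary_norm_sub_le
    (heq : ∀ p : A, IsStarProjection p → p ≠ 0 → MurrayVonNeumannEquiv 1 p)
    {s t : A} (hs : star s * s = 1) (ht : star t * t = 1) (hst : s * star s + t * star t = 1)
    {M L : A} (hM : IsStarNormal M) (hL : IsStarNormal L) (hMf : (spectrum ℂ M).Finite)
    (hLf : (spectrum ℂ L).Finite) {r : ℝ} (hr : 0 ≤ r)
    (hML : ∀ x ∈ spectrum ℂ M, ∃ y ∈ spectrum ℂ L, ‖x - y‖ ≤ r)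
    (hLM : ∀ y ∈ spectrum ℂ L, ∃ x ∈ spectrum ℂ M, ‖x - y‖ ≤ r) :
    ∃ u : A, star u * u = 1 ∧ u * star u = 1 ∧ ‖M - u * L * star u‖ ≤ r := by
  classical
  have := hMf.fintype
  have := hLf.fintype
  obtain ⟨w, hw, hMw⟩ := hM.exists_isCuntzFamily_of_finite_spectrum heq
  obtain ⟨w', hw', hLw⟩ := hL.exists_isCuntzFamily_of_finite_spectrum heq
  let κ : spectrum ℂ M → Type := fun x => {y : spectrum ℂ L // ‖(x : ℂ) - y‖ ≤ r}
  let κ' : spectrum ℂ L → Type := fun y => {x : spectrum ℂ M // ‖(x : ℂ) - y‖ ≤ r}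
  have hκ (x) : Nonempty (κ x) := by
    obtain ⟨y, hy, h⟩ := hML x x.2
    exact ⟨⟨y, hy⟩, h⟩
  have hκ' (y) : Nonempty (κ' y) := by
    obtain ⟨x, hx, h⟩ := hLM y y.2
    exact ⟨⟨x, hx⟩, h⟩
  choose a ha using fun x => IsCuntzFamily.exists_of_pair hs ht hst (κ x)
  choose b hb using fun y => IsCuntzFamily.exists_of_pair hs ht hst (κ' y)
  let e : (Σ x, κ x) ≃ (Σ y, κ' y) :=
    { toFun := fun p => ⟨p.2.1, p.1, p.2.2⟩
      invFun := fun p => ⟨p.2.1, p.1, p.2.2⟩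
      left_inv := fun p => rfl
      right_inv := fun p => rfl }
  have hv := hw.sigma ha
  have hv' := (hw'.sigma hb).comp_equiv e
  have expand {ι : Type} {κ : ι → Type} [Fintype ι] [DecidableEq ι] [∀ i, Fintype (κ i)]
      [∀ i, DecidableEq (κ i)] (w : ι → A) (x : ∀ i, κ i → A) (hx : ∀ i, IsCuntzFamily (x i))
      (c : ι → ℂ) : ∑ i, c i • (w i * star (w i)) =
        ∑ p : Σ i, κ i, c p.1 • (w p.1 * x p.1 p.2 * star (w p.1 * x p.1 p.2)) := by
    have h (i : ι) (a : κ i) : w i * x i a * star (w i * x i a) =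
        w i * (x i a * star (x i a)) * star (w i) := by
      simp only [star_mul, mul_assoc]
    simp only [Fintype.sum_sigma, h, ← Finset.smul_sum, ← Finset.sum_mul, ← Finset.mul_sum,
      (hx _).sum_mul_star, mul_one]
  obtain ⟨u, hu1, hu2, hu⟩ := hv.exists_unitary hv'
  refine ⟨u, hu1, hu2, ?_⟩
  rw [hMw, hLw, expand w a ha, expand w' b hb, ← e.sum_comp, Finset.mul_sum, Finset.sum_mul,
    ← Finset.sum_sub_distrib]
  have hterm (p : Σ x, κ x) :
      (p.1 : ℂ) • (w p.1 * a p.1 p.2 * star (w p.1 * a p.1 p.2)) -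
        u * (((e p).1 : ℂ) • (w' (e p).1 * b (e p).1 (e p).2 *
          star (w' (e p).1 * b (e p).1 (e p).2))) * star u =
      ((p.1 : ℂ) - (p.2.1 : ℂ)) • (w p.1 * a p.1 p.2 * star (w p.1 * a p.1 p.2)) := by
    have h2 : w p.1 * a p.1 p.2 = u * (w' (e p).1 * b (e p).1 (e p).2) := (hu p).symm
    rw [sub_smul, mul_smul_comm, smul_mul_assoc, h2, star_mul]
    simp only [mul_assoc, e, Equiv.coe_fn_mk]
  rw [Finset.sum_congr rfl fun p _ => hterm p]
  exact hv.norm_sum_smul_le hr fun p => p.2.2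

end FiniteSpectrum

/-! ### Nilpotent matrices close to self-adjoint matrices -/

section NilpotentMatrices

open scoped Matrix.Norms.L2Operator ComplexConjugate

open Matrix

/-- Discrete Fourier coefficients of the centred sawtooth function on `ℤ/m`. -/
lemma sum_sawtooth_mul_pow {z : ℂ} {m : ℕ} (hz : z ^ m = 1) (hz1 : z ≠ 1) :
    ∑ l ∈ Finset.range m, ((l : ℂ) - (m - 1) / 2) * z ^ l = m / (z - 1) := by
  have hz' : z - 1 ≠ 0 := sub_ne_zero.mpr hz1
  have h0 : ∑ l ∈ Finset.range m, z ^ l = 0 := by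
    rw [geom_sum_eq hz1, hz, sub_self, zero_div]
  have h1 (n : ℕ) : (∑ l ∈ Finset.range n, (l : ℂ) * z ^ l) * (z - 1) =
      n * z ^ n - z * ∑ l ∈ Finset.range n, z ^ l := by
    induction n with
    | zero => simp
    | succ n ih =>
      rw [Finset.sum_range_succ, Finset.sum_range_succ, add_mul, ih]
      push_cast
      ring
  simp only [sub_mul, Finset.sum_sub_distrib, ← Finset.mul_sum, h0, mul_zero, sub_zero]
  rw [eq_div_iff hz', h1, h0, hz]
  ring

lemma sum_sawtooth (m : ℕ) : ∑ l ∈ Finset.range m, ((l : ℂ) - (m - 1) / 2) = 0 := by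
  have h (n : ℕ) : ∑ l ∈ Finset.range n, (l : ℂ) = n * (n - 1) / 2 := by
    induction n with
    | zero => simp
    | succ n ih =>
      rw [Finset.sum_range_succ, ih]
      push_cast
      ring
  rw [Finset.sum_sub_distrib, h]
  simp
  ring

/-- A strictly upper triangular matrix is nilpotent. -/
lemma Matrix.isNilpotent_of_strictUpper {n : ℕ} {Q : Matrix (Fin n) (Fin n) ℂ}
    (hQ : ∀ i j, j ≤ i → Q i j = 0) : IsNilpotent Q := by
  refine ⟨n, ?_⟩
  have h := Q.aeval_self_charpoly
  have hup : Q.IsUpperTriangular := fun i j hij => hQ i j hij.le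
  rw [charpoly_of_isUpperTriangular Q hup] at h
  simpa [hQ _ _ le_rfl] using h

/-- The sum of all entries of a matrix is a value of its quadratic form. -/
lemma Matrix.norm_sum_le_card_mul_l2_opNorm {n : ℕ} (H : Matrix (Fin n) (Fin n) ℂ) :
    ‖∑ i, ∑ j, H i j‖ ≤ n * ‖H‖ := by
  let x : EuclideanSpace ℂ (Fin n) := WithLp.toLp 2 fun _ => 1
  have hx : ‖x‖ ^ 2 = n := by simp [x, EuclideanSpace.norm_sq_eq]
  have h1 : ∑ i, ∑ j, H i j = inner ℂ x (toEuclideanCLM (n := Fin n) (𝕜 := ℂ) H x) := by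
    simp [x, PiLp.inner_apply, Matrix.mulVec, dotProduct]
  rw [h1, ← hx]
  calc _ ≤ ‖x‖ * ‖toEuclideanCLM (n := Fin n) (𝕜 := ℂ) H x‖ := norm_inner_le_norm _ _
    _ ≤ ‖x‖ * (‖toEuclideanCLM (n := Fin n) (𝕜 := ℂ) H‖ * ‖x‖) := by
      gcongr
      exact ContinuousLinearMap.le_opNorm _ _
    _ = _ := by
      rw [l2_opNorm_toEuclideanCLM]
      ring

/-- A discrete Hilbert inequality: the skew-adjoint Toeplitz matrix with entries
`I / (ω ^ (j - i) - 1)` above the diagonal, `ω = exp (2πi/m)`, has norm at most `m / 2`. Up to the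
factor `m` it is the compression of a sawtooth multiplier by the discrete Fourier transform. -/
lemma norm_hilbertMatrix_sub_conjTranspose_le {n m : ℕ} (hnm : n ≤ m) (hn : 0 < n) {ω : ℂ}
    (hω : IsPrimitiveRoot ω m) {Q : Matrix (Fin n) (Fin n) ℂ}
    (hQ : ∀ i j, Q i j = if i < j then Complex.I / (ω ^ ((j : ℕ) - i) - 1) else 0) :
    ‖Q - Qᴴ‖ ≤ m / 2 := by
  have hm : 0 < m := hn.trans_le hnm
  have hm' : (m : ℂ) ≠ 0 := by exact_mod_cast hm.ne'
  have hmr : (0 : ℝ) < m := by exact_mod_cast hm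
  have hω1 : conj ω * ω = 1 := by
    rw [mul_comm, Complex.mul_conj, Complex.normSq_eq_norm_sq, hω.norm'_eq_one hm.ne']
    simp
  let d : ℕ → ℂ := fun l => (l : ℂ) - (m - 1) / 2
  let W : Matrix (Fin m) (Fin n) ℂ := of fun l j => ω ^ ((l : ℕ) * j)
  let D : Matrix (Fin m) (Fin m) ℂ := diagonal fun l => d l
  -- entries of a Fourier compression on and above the diagonal
  have hentry (c : ℕ → ℂ) (i j : Fin n) (hij : i ≤ j) :
      (Wᴴ * diagonal (fun l : Fin m => c l) * W) i j =
        ∑ l ∈ Finset.range m, c l * (ω ^ ((j : ℕ) - i)) ^ l := by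
    rw [Matrix.mul_assoc, Matrix.mul_apply, ← Fin.sum_univ_eq_sum_range (fun l => c l *
      (ω ^ ((j : ℕ) - i)) ^ l)]
    refine Finset.sum_congr rfl fun l _ => ?_
    obtain ⟨k, hk⟩ := Nat.exists_eq_add_of_le (Fin.le_def.mp hij)
    have e : conj ω ^ ((l : ℕ) * i) * ω ^ ((l : ℕ) * i) = 1 := by
      rw [← mul_pow, hω1, one_pow]
    simp only [conjTranspose_apply, diagonal_mul, W, of_apply, star_pow, RCLike.star_def, hk,
      Nat.add_sub_cancel_left, mul_add, pow_add, ← pow_mul]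
    rw [mul_comm k (l : ℕ)]
    linear_combination (c l * ω ^ ((l : ℕ) * k)) * e
  have hne (i j : Fin n) (hij : i < j) : ω ^ ((j : ℕ) - i) ≠ 1 := by
    refine hω.pow_ne_one_of_pos_of_lt ?_ ?_ <;> have := j.2 <;> have := Fin.lt_def.mp hij <;> omega
  have hroot (k : ℕ) : (ω ^ k) ^ m = 1 := by rw [← pow_mul, mul_comm, pow_mul, hω.pow_eq_one, one_pow]
  have hWW : Wᴴ * W = (m : ℂ) • (1 : Matrix (Fin n) (Fin n) ℂ) := by
    have hup (i j : Fin n) (hij : i ≤ j) : (Wᴴ * W) i j = if i = j then (m : ℂ) else 0 := by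
      have := hentry (fun _ => 1) i j hij
      simp only [diagonal_one, Matrix.mul_one, one_mul] at this
      rw [this]
      split_ifs with h
      · simp [h]
      · rw [geom_sum_eq (hne i j (lt_of_le_of_ne hij h)), hroot, sub_self, zero_div]
    have hherm : (Wᴴ * W)ᴴ = Wᴴ * W := by simp
    ext i j
    rcases le_total i j with hij | hij
    · rw [hup i j hij]
      simp [Matrix.one_apply]
    · rw [← hherm, conjTranspose_apply, hup j i hij]
      by_cases h : i = j
      · simp [h]
      · simp [h, Ne.symm h]
  have hW : ‖W‖ * ‖W‖ = m := by
    have : Nonempty (Fin n) := ⟨⟨0, hn⟩⟩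
    rw [← l2_opNorm_conjTranspose_mul_self, hWW, norm_smul, norm_one]
    simp
  have hD : ‖D‖ ≤ m / 2 := by
    rw [l2_opNorm_diagonal]
    refine (pi_norm_le_iff_of_nonneg (by positivity)).mpr fun l => ?_
    have e : d l = (((l : ℕ) - ((m : ℝ) - 1) / 2 : ℝ) : ℂ) := by simp [d]
    have h1 : ((l : ℕ) : ℝ) + 1 ≤ m := by exact_mod_cast l.2
    have h2 : (0 : ℝ) ≤ (l : ℕ) := Nat.cast_nonneg _
    rw [e, Complex.norm_real, Real.norm_eq_abs, abs_le]
    constructor <;> linarith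
  have hDh : (Wᴴ * D * W)ᴴ = Wᴴ * D * W := by
    have : Dᴴ = D := by
      simp only [D, diagonal_conjTranspose]
      congr 1
      ext l
      simp [d]
    simp [this, Matrix.mul_assoc]
  have hQB : Q - Qᴴ = (Complex.I / m) • (Wᴴ * D * W) := by
    have hup (i j : Fin n) (hij : i ≤ j) : (Wᴴ * D * W) i j = if i < j then
        m / (ω ^ ((j : ℕ) - i) - 1) else 0 := by
      rw [hentry d i j hij]
      split_ifs with h
      · exact sum_sawtooth_mul_pow (hroot _) (hne i j h)
      · have : i = j := le_antisymm hij (not_lt.mp h)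
        simpa only [this, Nat.sub_self, pow_zero, one_pow, mul_one] using sum_sawtooth m
    have key (i j : Fin n) (hij : i ≤ j) :
        (Q - Qᴴ) i j = (Complex.I / m) * (Wᴴ * D * W) i j := by
      rw [hup i j hij, Matrix.sub_apply, conjTranspose_apply, hQ, hQ, if_neg (not_lt.mpr hij)]
      split_ifs
      · simp
        field_simp
      · simp
    ext i j
    rcases le_total i j with hij | hij
    · exact key i j hij
    · have h1 : (Q - Qᴴ) i j = -conj ((Q - Qᴴ) j i) := by simp
      have h2 : (Wᴴ * D * W) i j = conj ((Wᴴ * D * W) j i) := by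
        conv_lhs => rw [← hDh]
        rfl
      rw [h1, key j i hij, Matrix.smul_apply, smul_eq_mul, h2]
      simp
      ring
  rw [hQB, norm_smul]
  calc ‖Complex.I / (m : ℂ)‖ * ‖Wᴴ * D * W‖ ≤ 1 / m * (‖W‖ * (m / 2) * ‖W‖) := by
        have e : ‖Complex.I / (m : ℂ)‖ = 1 / m := by simp
        rw [e]
        gcongr
        refine (l2_opNorm_mul _ _).trans ?_
        gcongr
        refine (l2_opNorm_mul _ _).trans ?_
        rw [l2_opNorm_conjTranspose]
        gcongr
    _ = 1 / m * ((‖W‖ * ‖W‖) * (m / 2)) := by ring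
    _ = m / 2 := by
        rw [hW]
        field_simp

/-- The row sums of the upper triangular part of the Hilbert matrix are harmonic numbers. -/
lemma sum_fin_one_div_sub (n : ℕ) (j : Fin n) :
    ∑ i : Fin n, (if i < j then 1 / (((j : ℕ) - (i : ℕ) : ℕ) : ℝ) else 0) =
      ∑ k ∈ Finset.range j, 1 / ((k : ℝ) + 1) := by
  rw [← Finset.sum_range_reflect]
  simp only [Fin.lt_def]
  rw [Fin.sum_univ_eq_sum_range (fun i => if i < (j : ℕ) then 1 / (((j : ℕ) - i : ℕ) : ℝ) else 0)]
  rw [← Finset.sum_filter]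
  have : (Finset.range n).filter (fun i => i < (j : ℕ)) = Finset.range j := by
    ext i
    have := j.2
    simp only [Finset.mem_filter, Finset.mem_range]
    omega
  rw [this]
  refine Finset.sum_congr rfl fun i hi => ?_
  rw [Finset.mem_range] at hi
  have : (j : ℕ) - i = (j - 1 - i) + 1 := by omega
  rw [this]
  push_cast
  rfl

/-- There are nilpotent matrices arbitrarily close to self-adjoint matrices of norm one. The
nilpotents are multiples of the upper triangular part of a (discrete) Hilbert matrix: the skew
part stays bounded while the self-adjoint part grows like a harmonic number. -/
lemma exists_isNilpotent_norm_sub_le {ε : ℝ} (hε : 0 < ε) :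
    ∃ (n : ℕ) (_ : 0 < n) (Q H : Matrix (Fin n) (Fin n) ℂ),
      IsNilpotent Q ∧ IsSelfAdjoint H ∧ ‖H‖ = 1 ∧ ‖Q - H‖ ≤ ε := by
  have hC : 0 < 5 / ε := by positivity
  obtain ⟨n₀, hn₀⟩ := Filter.eventually_atTop.mp
    (Real.tendsto_sum_range_one_div_nat_succ_atTop.eventually_ge_atTop (5 / ε))
  have hn₀pos : 0 < n₀ := by
    rcases Nat.eq_zero_or_pos n₀ with h | h
    · have := hn₀ 0 h.le
      simp at this
      linarith [show 0 < 5 / ε from hC]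
    · exact h
  set n := 2 * n₀ with hn
  have hnpos : 0 < n := by omega
  have hnr : (0 : ℝ) < n := by exact_mod_cast hnpos
  let ω : ℂ := Complex.exp (2 * Real.pi * Complex.I / ((4 * n : ℕ) : ℂ))
  have hω : IsPrimitiveRoot ω (4 * n) := Complex.isPrimitiveRoot_exp _ (by omega)
  let Q : Matrix (Fin n) (Fin n) ℂ :=
    of fun i j => if i < j then Complex.I / (ω ^ ((j : ℕ) - i) - 1) else 0
  let H : Matrix (Fin n) (Fin n) ℂ := (1 / 2 : ℂ) • (Q + Qᴴ)
  have hQnil : IsNilpotent Q := isNilpotent_of_strictUpper fun i j hij => by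
    simp [Q, not_lt.mpr hij]
  have hH : IsSelfAdjoint H := by
    rw [IsSelfAdjoint, star_eq_conjTranspose]
    simp [H, add_comm]
  have hQH : ‖Q - H‖ ≤ n := by
    have e : Q - H = (1 / 2 : ℂ) • (Q - Qᴴ) := by
      simp only [H]
      module
    have := norm_hilbertMatrix_sub_conjTranspose_le (Q := Q) (by omega) hnpos hω fun i j => rfl
    rw [e, norm_smul]
    push_cast at this
    norm_num
    linarith
  -- on the first quarter of the circle, `sin φ / |exp (iφ) - 1| ^ 2 ≥ 2 / (π φ)`
  have hre (k : ℕ) (hk : 0 < k) (hkn : k < n) :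
      4 * n / Real.pi ^ 2 * (1 / (k : ℝ)) ≤ (Complex.I / (ω ^ k - 1)).re := by
    have hkr : (0 : ℝ) < k := by exact_mod_cast hk
    have hkn' : (k : ℝ) < n := by exact_mod_cast hkn
    have hpi := Real.pi_pos
    set φ : ℝ := k * Real.pi / (2 * n) with hφ
    have hφ0 : 0 < φ := by positivity
    have hφ1 : φ ≤ Real.pi / 2 := by
      rw [hφ, div_le_div_iff₀ (by positivity) (by norm_num)]
      nlinarith
    have hωk : ω ^ k = Complex.exp (Complex.I * φ) := by
      rw [← Complex.exp_nat_mul]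
      congr 1
      have : (n : ℂ) ≠ 0 := by exact_mod_cast hnpos.ne'
      rw [hφ]
      push_cast
      field_simp
      ring
    have hsin := Real.mul_le_sin hφ0.le hφ1
    have hnorm : ‖Complex.exp (Complex.I * φ) - 1‖ ≤ φ := by
      simpa [abs_of_pos hφ0] using Real.norm_exp_I_mul_ofReal_sub_one_le (x := φ)
    have hne : Complex.exp (Complex.I * φ) - 1 ≠ 0 := by
      rw [← hωk]
      exact sub_ne_zero.mpr (hω.pow_ne_one_of_pos_of_lt hk.ne' (by omega))
    have hre' : (Complex.I / (ω ^ k - 1)).re =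
        Real.sin φ / ‖Complex.exp (Complex.I * φ) - 1‖ ^ 2 := by
      rw [hωk, Complex.div_re, Complex.normSq_eq_norm_sq]
      have h2 : (Complex.exp (Complex.I * φ) - 1).im = Real.sin φ := by
        rw [mul_comm, Complex.sub_im, Complex.exp_ofReal_mul_I_im]
        simp
      simp [h2]
    rw [hre']
    have hpos : 0 < ‖Complex.exp (Complex.I * φ) - 1‖ := norm_pos_iff.mpr hne
    calc 4 * n / Real.pi ^ 2 * (1 / (k : ℝ)) = (2 / Real.pi * φ) / φ ^ 2 := by
          rw [hφ]
          field_simp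
          ring
      _ ≤ Real.sin φ / φ ^ 2 := by gcongr
      _ ≤ _ := by
          have : 0 ≤ Real.sin φ := le_trans (by positivity) hsin
          gcongr
  have hsumH : 2 * n ^ 2 / Real.pi ^ 2 * (5 / ε) ≤ ‖∑ i, ∑ j, H i j‖ := by
    have hpi := Real.pi_pos
    refine le_trans ?_ (Complex.re_le_norm _)
    have e : (∑ i, ∑ j, H i j).re = ∑ j, ∑ i, (Q i j).re := by
      have h2 (i j : Fin n) : (H i j).re = 1 / 2 * ((Q i j).re + (Q j i).re) := by
        simp only [H, Matrix.smul_apply, Matrix.add_apply, conjTranspose_apply, smul_eq_mul]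
        simp [Complex.mul_re]
      simp only [Complex.re_sum, h2, ← Finset.mul_sum, Finset.sum_add_distrib]
      rw [Finset.sum_comm]
      ring
    rw [e]
    have hrow (j : Fin n) : 4 * n / Real.pi ^ 2 * ∑ k ∈ Finset.range j, 1 / ((k : ℝ) + 1) ≤
        ∑ i, (Q i j).re := by
      rw [← sum_fin_one_div_sub, Finset.mul_sum]
      refine Finset.sum_le_sum fun i _ => ?_
      simp only [Q, of_apply]
      split_ifs with h
      · have := j.2
        have := Fin.lt_def.mp h
        exact hre _ (by omega) (by omega)
      · simp
    refine le_trans ?_ (Finset.sum_le_sum fun j _ => hrow j)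
    rw [← Finset.mul_sum]
    have hhalf : n₀ * (5 / ε) ≤ ∑ j : Fin n, ∑ k ∈ Finset.range (j : ℕ), 1 / ((k : ℝ) + 1) := by
      rw [Fin.sum_univ_eq_sum_range (fun j => ∑ k ∈ Finset.range j, 1 / ((k : ℝ) + 1)), hn, two_mul,
        Finset.sum_range_add]
      have h1 : 0 ≤ ∑ j ∈ Finset.range n₀, ∑ k ∈ Finset.range j, 1 / ((k : ℝ) + 1) :=
        Finset.sum_nonneg fun j _ => Finset.sum_nonneg fun k _ => by positivity
      have h2 : n₀ * (5 / ε) ≤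
          ∑ j ∈ Finset.range n₀, ∑ k ∈ Finset.range (n₀ + j), 1 / ((k : ℝ) + 1) := by
        have := Finset.card_nsmul_le_sum (Finset.range n₀)
          (fun j => ∑ k ∈ Finset.range (n₀ + j), 1 / ((k : ℝ) + 1)) (5 / ε)
          fun j _ => hn₀ _ (by omega)
        simpa using this
      linarith
    calc 2 * (n : ℝ) ^ 2 / Real.pi ^ 2 * (5 / ε) = 4 * n / Real.pi ^ 2 * (n₀ * (5 / ε)) := by
          rw [hn]
          push_cast
          ring
      _ ≤ _ := by gcongr
  have hHbig : n / ε ≤ ‖H‖ := by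
    have h1 := hsumH.trans (norm_sum_le_card_mul_l2_opNorm H)
    have hpi := Real.pi_pos
    have hpi2 : Real.pi ^ 2 ≤ 10 := by nlinarith [Real.pi_lt_d2]
    have h2 : n * (n / ε) ≤ 2 * n ^ 2 / Real.pi ^ 2 * (5 / ε) := by
      have : 2 * (n : ℝ) ^ 2 / Real.pi ^ 2 * (5 / ε) = 10 / Real.pi ^ 2 * (n * (n / ε)) := by ring
      rw [this]
      refine le_mul_of_one_le_left (by positivity) ?_
      rwa [one_le_div (by positivity)]
    exact le_of_mul_le_mul_left (h2.trans h1) hnr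
  have hHpos : 0 < ‖H‖ := lt_of_lt_of_le (by positivity) hHbig
  refine ⟨n, hnpos, ((‖H‖⁻¹ : ℝ) : ℂ) • Q, ((‖H‖⁻¹ : ℝ) : ℂ) • H, hQnil.smul _, ?_, ?_, ?_⟩
  · refine IsSelfAdjoint.smul ?_ hH
    simp [IsSelfAdjoint]
  · rw [norm_smul]
    simp [hHpos.ne']
  · rw [← smul_sub, norm_smul]
    have e : ‖((‖H‖⁻¹ : ℝ) : ℂ)‖ = ‖H‖⁻¹ := by simp
    rw [e, inv_mul_le_iff₀ hHpos]
    have := (div_le_iff₀ hε).mp hHbig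
    exact hQH.trans this

end NilpotentMatrices

/-! ### The Cauchy–Riemann operator and Cauchy integrals over the plane -/

section CauchyRiemann

open MeasureTheory Complex

/-- The Cauchy–Riemann operator `∂f/∂x + i ∂f/∂y`, which is twice the Wirtinger derivative of `f`
with respect to the conjugate variable. -/
noncomputable def dbar (f : ℂ → ℂ) (w : ℂ) : ℂ := fderiv ℝ f w 1 + I * fderiv ℝ f w I

variable {f h : ℂ → ℂ}

lemma continuous_dbar (hf : ContDiff ℝ 1 f) : Continuous (dbar f) := by
  have := hf.continuous_fderiv one_ne_zero
  unfold dbar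
  fun_prop

lemma tsupport_dbar_subset : tsupport (dbar f) ⊆ tsupport f := by
  refine (closure_mono ?_).trans (closure_minimal (support_fderiv_subset ℝ) (isClosed_tsupport f))
  intro w hw h
  refine hw ?_
  rw [dbar, h]
  simp

lemma HasCompactSupport.dbar (hc : HasCompactSupport f) : HasCompactSupport (dbar f) :=
  hc.of_isClosed_subset (isClosed_tsupport _) tsupport_dbar_subset

lemma dbar_congr {w : ℂ} (hfh : f =ᶠ[nhds w] h) : dbar f w = dbar h w := by
  rw [dbar, dbar, hfh.fderiv_eq]

lemma dbar_sub {w : ℂ} (hf : DifferentiableAt ℝ f w) (hh : DifferentiableAt ℝ h w) :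
    dbar (f - h) w = dbar f w - dbar h w := by
  simp only [dbar, fderiv_sub hf hh, _root_.sub_apply]
  ring

lemma dbar_mul_of_differentiableAt {w : ℂ} (hf : DifferentiableAt ℝ f w)
    (hh : DifferentiableAt ℂ h w) : dbar (f * h) w = dbar f w * h w := by
  have hI : (fderiv ℂ h w) I = I * (fderiv ℂ h w) 1 := by
    rw [← smul_eq_mul, ← map_smul, smul_eq_mul, mul_one]
  simp only [dbar, fderiv_mul hf (hh.restrictScalars ℝ), hh.fderiv_restrictScalars ℝ,
    _root_.add_apply, _root_.smul_apply, ContinuousLinearMap.coe_restrictScalars', hI, smul_eq_mul]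
  linear_combination (f w * fderiv ℂ h w 1) * I_mul_I

lemma integral_dbar_eq_zero (hf : ContDiff ℝ 1 f) (hc : HasCompactSupport f) :
    ∫ w, dbar f w = 0 := by
  have hcont := hf.continuous_fderiv one_ne_zero
  have hint (v : ℂ) : Integrable fun w => fderiv ℝ f w v :=
    Continuous.integrable_of_hasCompactSupport (by fun_prop) (hc.fderiv_apply ℝ v)
  have hz (v : ℂ) : ∫ w, fderiv ℝ f w v = 0 := by
    have := integral_mul_fderiv_eq_neg_fderiv_mul_of_integrable (𝕜 := ℂ) (μ := volume)
      (f := fun _ : ℂ => (1 : ℂ)) (g := f) (v := v) (by simp) (by simpa using hint v)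
      (by simpa using hf.continuous.integrable_of_hasCompactSupport hc)
      (fun x _ => differentiableAt_const _) (fun x _ => hf.differentiable one_ne_zero x)
    simpa using this
  simp only [dbar]
  rw [integral_add (hint 1) ((hint I).const_mul I), integral_const_mul, hz, hz]
  simp

/-- Multiplying a compactly supported function by a function that is holomorphic near its support
multiplies the Cauchy–Riemann derivative, and keeps the smoothness and the support. -/
lemma dbar_mul_of_contDiffAt (hf : ContDiff ℝ 1 f) (hc : HasCompactSupport f)
    (hh : ∀ w ∈ tsupport f, ContDiffAt ℂ 1 h w) :
    ContDiff ℝ 1 (f * h) ∧ HasCompactSupport (f * h) ∧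
      ∀ w, dbar (f * h) w = dbar f w * h w := by
  have hzero (w : ℂ) (hw : w ∉ tsupport f) : f =ᶠ[nhds w] 0 := notMem_tsupport_iff_eventuallyEq.mp hw
  have hzero' (w : ℂ) (hw : w ∉ tsupport f) : f * h =ᶠ[nhds w] 0 := by
    filter_upwards [hzero w hw] with x hx
    simp [hx]
  refine ⟨contDiff_iff_contDiffAt.mpr fun w => ?_, hc.mul_right, fun w => ?_⟩ <;>
    by_cases hw : w ∈ tsupport f
  · exact hf.contDiffAt.mul ((hh w hw).restrict_scalars ℝ)
  · exact contDiffAt_const.congr_of_eventuallyEq (hzero' w hw)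
  · exact dbar_mul_of_differentiableAt (hf.differentiable one_ne_zero w)
      ((hh w hw).differentiableAt one_ne_zero)
  · rw [dbar_congr (hzero' w hw), dbar_congr (hzero w hw)]
    simp [dbar]

lemma contDiffAt_inv_sub_pow {z w : ℂ} (hw : w ≠ z) (k : ℕ) :
    ContDiffAt ℂ 1 (fun w => ((w - z) ^ k)⁻¹) w :=
  ContDiffAt.inv (by fun_prop) (pow_ne_zero _ (sub_ne_zero.mpr hw))

/-- If `f` vanishes near `z`, then the negative moments of `dbar f` about `z` vanish. -/
lemma integral_dbar_mul_inv_pow_eq_zero (hf : ContDiff ℝ 1 f) (hc : HasCompactSupport f) {z : ℂ}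
    (hz : z ∉ tsupport f) (k : ℕ) :
    Integrable (fun w => dbar f w * ((w - z) ^ k)⁻¹) ∧
      ∫ w, dbar f w * ((w - z) ^ k)⁻¹ = 0 := by
  obtain ⟨h1, h2, h3⟩ := dbar_mul_of_contDiffAt hf hc (h := fun w => ((w - z) ^ k)⁻¹)
    fun w hw => contDiffAt_inv_sub_pow (by rintro rfl; exact hz hw) k
  simp only [← h3]
  exact ⟨(continuous_dbar h1).integrable_of_hasCompactSupport h2.dbar, integral_dbar_eq_zero h1 h2⟩

/-- A smooth radial cutoff function, equal to `1` on the closed disc of radius `r` about `z` and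
to `0` outside the disc of radius `R`. -/
noncomputable def radialCutoff (z : ℂ) (r R : ℝ) (w : ℂ) : ℂ :=
  (Real.smoothTransition ((R ^ 2 - ‖w - z‖ ^ 2) / (R ^ 2 - r ^ 2)) : ℝ)

variable {z : ℂ} {r R : ℝ}

lemma contDiff_radialCutoff : ContDiff ℝ 1 (radialCutoff z r R) := by
  refine ofRealCLM.contDiff.comp ((Real.smoothTransition.contDiff (n := 1)).comp ?_)
  exact (contDiff_const.sub ((contDiff_id.sub contDiff_const).norm_sq ℝ)).div_const _

lemma radialCutoff_of_le (hr : 0 ≤ r) (hrR : r < R) {w : ℂ} (hw : ‖w - z‖ ≤ r) :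
    radialCutoff z r R w = 1 := by
  have : 0 < R ^ 2 - r ^ 2 := by nlinarith
  rw [radialCutoff, Real.smoothTransition.one_of_one_le, ofReal_one]
  rw [le_div_iff₀ this]
  nlinarith [norm_nonneg (w - z)]

lemma radialCutoff_of_ge (hr : 0 ≤ r) (hrR : r < R) {w : ℂ} (hw : R ≤ ‖w - z‖) :
    radialCutoff z r R w = 0 := by
  have : 0 < R ^ 2 - r ^ 2 := by nlinarith
  rw [radialCutoff, Real.smoothTransition.zero_of_nonpos, ofReal_zero]
  refine div_nonpos_of_nonpos_of_nonneg ?_ this.le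
  nlinarith

lemma tsupport_radialCutoff_subset (hr : 0 ≤ r) (hrR : r < R) :
    tsupport (radialCutoff z r R) ⊆ Metric.closedBall z R := by
  refine closure_minimal (fun w hw => ?_) Metric.isClosed_closedBall
  by_contra h
  rw [Metric.mem_closedBall, dist_eq_norm, not_le] at h
  exact hw (radialCutoff_of_ge hr hrR h.le)

lemma hasCompactSupport_radialCutoff (hr : 0 ≤ r) (hrR : r < R) :
    HasCompactSupport (radialCutoff z r R) :=
  (isCompact_closedBall z R).of_isClosed_subset (isClosed_tsupport _)
    (tsupport_radialCutoff_subset hr hrR)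

/-- The Cauchy–Riemann derivative of a cutoff function lives on the annulus between its radii. -/
lemma dbar_radialCutoff_eq_zero (hr : 0 ≤ r) (hrR : r < R) {w : ℂ}
    (hw : ‖w - z‖ < r ∨ R < ‖w - z‖) : dbar (radialCutoff z r R) w = 0 := by
  have hcont : Continuous fun w : ℂ => ‖w - z‖ := by fun_prop
  rcases hw with hw | hw
  · have : radialCutoff z r R =ᶠ[nhds w] fun _ => 1 := by
      filter_upwards [hcont.continuousAt.eventually_lt_const hw] with x hx
      exact radialCutoff_of_le hr hrR hx.le
    rw [dbar_congr this]
    simp [dbar]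
  · have : radialCutoff z r R =ᶠ[nhds w] fun _ => 0 := by
      filter_upwards [hcont.continuousAt.eventually_const_lt hw] with x hx
      exact radialCutoff_of_ge hr hrR hx.le
    rw [dbar_congr this]
    simp [dbar]

lemma dbar_radialCutoff (w : ℂ) : dbar (radialCutoff z r R) w =
    ((deriv Real.smoothTransition ((R ^ 2 - ‖w - z‖ ^ 2) / (R ^ 2 - r ^ 2)) *
      (-2 / (R ^ 2 - r ^ 2)) : ℝ) : ℂ) * (w - z) := by
  have h1 : HasFDerivAt (fun w : ℂ => (R ^ 2 - ‖w - z‖ ^ 2) / (R ^ 2 - r ^ 2))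
      ((R ^ 2 - r ^ 2)⁻¹ • -((2 : ℝ) • innerSL ℝ (w - z))) w := by
    have := ((hasFDerivAt_id (𝕜 := ℝ) w).sub_const z).norm_sq
    have := (this.const_sub (R ^ 2)).const_mul (R ^ 2 - r ^ 2)⁻¹
    refine (this.congr_of_eventuallyEq ?_).congr_fderiv ?_
    · filter_upwards with x
      simp [div_eq_inv_mul]
    · ext v
      simp
  have h2 := (((Real.smoothTransition.contDiff (n := 1)).differentiable one_ne_zero _).hasDerivAt
    |>.hasFDerivAt.comp w h1)
  have h3 : HasFDerivAt (radialCutoff z r R) _ w := ofRealCLM.hasFDerivAt.comp w h2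
  have h4 (v : ℂ) : fderiv ℝ (radialCutoff z r R) w v =
      (((R ^ 2 - r ^ 2)⁻¹ * -(2 * inner ℝ (w - z) v) *
        deriv Real.smoothTransition ((R ^ 2 - ‖w - z‖ ^ 2) / (R ^ 2 - r ^ 2)) : ℝ) : ℂ) := by
    rw [h3.fderiv]
    rfl
  rw [dbar, h4, h4]
  generalize deriv Real.smoothTransition ((R ^ 2 - ‖w - z‖ ^ 2) / (R ^ 2 - r ^ 2)) = s
  rw [div_eq_mul_inv]
  generalize (R ^ 2 - r ^ 2)⁻¹ = c
  apply Complex.ext <;> simp [Complex.inner] <;> ring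

lemma exists_deriv_smoothTransition_ne_zero : ∃ t : ℝ, deriv Real.smoothTransition t ≠ 0 := by
  by_contra! h
  have := is_const_of_deriv_eq_zero
    ((Real.smoothTransition.contDiff (n := 1)).differentiable one_ne_zero) h 0 1
  simp at this

lemma deriv_smoothTransition_eq_zero {t : ℝ} (ht : t < 0 ∨ 1 < t) :
    deriv Real.smoothTransition t = 0 := by
  rcases ht with ht | ht
  · have : Real.smoothTransition =ᶠ[nhds t] fun _ => 0 := by
      filter_upwards [gt_mem_nhds ht] with x hx
      exact Real.smoothTransition.zero_of_nonpos hx.le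
    rw [this.deriv_eq, deriv_const]
  · have : Real.smoothTransition =ᶠ[nhds t] fun _ => 1 := by
      filter_upwards [lt_mem_nhds ht] with x hx
      exact Real.smoothTransition.one_of_one_le hx.le
    rw [this.deriv_eq, deriv_const]

/-- The Cauchy integral of the Cauchy–Riemann derivative of a radial cutoff function does not
vanish at the centre: in polar form the integrand has constant sign. -/
lemma integral_dbar_radialCutoff_ne_zero (hr : 0 < r) (hrR : r < R) :
    ∫ w, dbar (radialCutoff z r R) w * (w - z)⁻¹ ≠ 0 := by
  have hpos : 0 < R ^ 2 - r ^ 2 := by nlinarith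
  let q : ℂ → ℝ := fun w => (R ^ 2 - ‖w - z‖ ^ 2) / (R ^ 2 - r ^ 2)
  have hq : Continuous q := by fun_prop
  let g : ℂ → ℝ := fun w => deriv Real.smoothTransition (q w)
  have hd : Continuous (deriv Real.smoothTransition) :=
    (Real.smoothTransition.contDiff (n := 1)).continuous_deriv le_rfl
  have hg : Continuous g := hd.comp hq
  have hgc : HasCompactSupport g := by
    refine HasCompactSupport.of_support_subset_isCompact (isCompact_closedBall z R) fun w hw => ?_
    by_contra h
    rw [Metric.mem_closedBall, dist_eq_norm, not_le] at h
    refine hw (deriv_smoothTransition_eq_zero (Or.inl ?_))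
    exact div_neg_of_neg_of_pos (by nlinarith) hpos
  obtain ⟨t, ht⟩ := exists_deriv_smoothTransition_ne_zero
  have ht1 : t ≤ 1 := by
    by_contra h
    exact ht (deriv_smoothTransition_eq_zero (Or.inr (not_le.mp h)))
  have hw : g (z + (√(R ^ 2 - t * (R ^ 2 - r ^ 2)) : ℝ)) ≠ 0 := by
    have h0 : 0 ≤ R ^ 2 - t * (R ^ 2 - r ^ 2) := by nlinarith
    have : q (z + (√(R ^ 2 - t * (R ^ 2 - r ^ 2)) : ℝ)) = t := by
      simp only [q, add_sub_cancel_left, norm_real, Real.norm_eq_abs, sq_abs, Real.sq_sqrt h0]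
      field_simp
      ring
    simpa [g, this] using ht
  have hgpos := hg.integral_pos_of_hasCompactSupport_nonneg_nonzero (μ := volume) hgc
    (fun w => Real.smoothTransition.monotone.deriv_nonneg) hw
  have hcongr : (fun w => dbar (radialCutoff z r R) w * (w - z)⁻¹) =
      fun w => ((g w * (-2 / (R ^ 2 - r ^ 2)) : ℝ) : ℂ) := by
    ext w
    by_cases hwz : w = z
    · have : g w = 0 := by
        refine deriv_smoothTransition_eq_zero (Or.inr ?_)
        simp only [q, hwz, sub_self, norm_zero]
        rw [lt_div_iff₀ hpos]
        nlinarith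
      rw [this]
      simp [hwz]
    · rw [dbar_radialCutoff, mul_assoc, mul_inv_cancel₀ (sub_ne_zero.mpr hwz), mul_one]
  rw [hcongr, integral_complex_ofReal, integral_mul_const]
  have h2 : -2 / (R ^ 2 - r ^ 2) ≠ 0 := div_ne_zero (by norm_num) hpos.ne'
  exact_mod_cast mul_ne_zero hgpos.ne' h2

/-- A weak form of the Cauchy–Pompeiu formula: the Cauchy integral of `dbar f` does not vanish at
a point near which `f` equals `1`. -/
lemma integral_dbar_mul_inv_ne_zero (hf : ContDiff ℝ 1 f) (hc : HasCompactSupport f) {z : ℂ}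
    (hz : f =ᶠ[nhds z] 1) : ∫ w, dbar f w * (w - z)⁻¹ ≠ 0 := by
  obtain ⟨ε, hε, hball⟩ := Metric.eventually_nhds_iff.mp hz
  set χ := radialCutoff z (ε / 2) ε with hχ
  have hχ1 : ContDiff ℝ 1 χ := contDiff_radialCutoff
  have hχc : HasCompactSupport χ := hasCompactSupport_radialCutoff (by positivity) (by linarith)
  have hsub : z ∉ tsupport (f - χ) := by
    rw [notMem_tsupport_iff_eventuallyEq]
    filter_upwards [Metric.ball_mem_nhds z (half_pos hε)] with w hw
    have hw' : dist w z < ε / 2 := hw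
    have e1 : f w = 1 := hball (hw'.trans (half_lt_self hε))
    have e2 : χ w = 1 := radialCutoff_of_le (by positivity) (by linarith)
      (by rw [← dist_eq_norm]; exact hw'.le)
    simp [e1, e2]
  obtain ⟨hi, h0⟩ := integral_dbar_mul_inv_pow_eq_zero (f := f - χ) (hf.sub hχ1) (hc.sub hχc) hsub 1
  have hne := integral_dbar_radialCutoff_ne_zero (z := z) (half_pos hε) (half_lt_self hε)
  have hint := Integrable.of_integral_ne_zero hne
  have hsplit : (fun w => dbar f w * (w - z)⁻¹) = fun w =>
      dbar χ w * (w - z)⁻¹ + dbar (f - χ) w * ((w - z) ^ 1)⁻¹ := by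
    ext w
    rw [dbar_sub (hf.differentiable one_ne_zero w) (hχ1.differentiable one_ne_zero w), pow_one]
    ring
  rw [hsplit, integral_add hint hi, h0, add_zero]
  exact hne

end CauchyRiemann

/-! ### Normal elements close to nilpotent elements -/

section NilpotentApproximation

open MeasureTheory

variable {A : Type*} [CStarAlgebra A]

lemma IsStarNormal.cfc_inv_sub_eq_resolvent {N : A} (hN : IsStarNormal N) {w : ℂ}
    (hw : w ∉ spectrum ℂ N) : cfc (fun z => (w - z)⁻¹) N = resolvent N w := by
  have h0 : ∀ z ∈ spectrum ℂ N, w - z ≠ 0 := fun z hz h => hw (sub_eq_zero.mp h ▸ hz)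
  rw [cfc_inv (fun z => w - z) N h0, resolvent, cfc_sub (fun _ => w) (fun z => z) N,
    cfc_const w N, cfc_id' ℂ N]

lemma IsStarNormal.norm_resolvent_le {N : A} (hN : IsStarNormal N) {w : ℂ} {d : ℝ} (hd : 0 < d)
    (hw : ∀ z ∈ spectrum ℂ N, d ≤ ‖w - z‖) : ‖resolvent N w‖ ≤ d⁻¹ := by
  have hw' : w ∉ spectrum ℂ N := fun h => by simpa using hd.trans_le (hw w h)
  rw [← hN.cfc_inv_sub_eq_resolvent hw']
  refine norm_cfc_le (by positivity) fun z hz => ?_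
  rw [norm_inv]
  exact inv_anti₀ hd (hw z hz)

/-- The resolvent of `Q` is close to that of a nearby normal element `N`, uniformly at the points
at distance at least `d` from the spectrum of `N`. -/
lemma IsStarNormal.norm_resolvent_sub_resolvent_le {N Q : A} (hN : IsStarNormal N) {w : ℂ} {d : ℝ}
    (hd : 0 < d) (hw : ∀ z ∈ spectrum ℂ N, d ≤ ‖w - z‖) (hwQ : w ∉ spectrum ℂ Q)
    (hNQ : ‖N - Q‖ ≤ d / 2) :
    ‖resolvent N w - resolvent Q w‖ ≤ 2 / d ^ 2 * ‖N - Q‖ := by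
  have hwN : w ∉ spectrum ℂ N := fun h => by simpa using hd.trans_le (hw w h)
  have hid : resolvent N w - resolvent Q w = resolvent N w * (N - Q) * resolvent Q w := by
    obtain ⟨u, hu⟩ := spectrum.notMem_iff.mp hwN
    obtain ⟨v, hv⟩ := spectrum.notMem_iff.mp hwQ
    have e : N - Q = (v : A) - u := by rw [hu, hv]; abel
    rw [resolvent, resolvent, ← hu, ← hv, Ring.inverse_unit, Ring.inverse_unit, e]
    simp [mul_sub, sub_mul, mul_assoc]
  have hR := hN.norm_resolvent_le hd hw
  have h1 : ‖resolvent N w - resolvent Q w‖ ≤ d⁻¹ * ‖N - Q‖ * ‖resolvent Q w‖ := by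
    rw [hid]
    refine (norm_mul_le _ _).trans ?_
    gcongr
    refine (norm_mul_le _ _).trans ?_
    gcongr
  have h2 : ‖resolvent Q w‖ ≤ 2 * d⁻¹ := by
    have h3 : ‖resolvent Q w‖ ≤ ‖resolvent N w‖ + ‖resolvent N w - resolvent Q w‖ := by
      rw [norm_sub_rev]
      exact norm_le_norm_add_norm_sub' _ _
    have h4 : d⁻¹ * ‖N - Q‖ * ‖resolvent Q w‖ ≤ d⁻¹ * (d / 2) * ‖resolvent Q w‖ := by gcongr
    have h5 : d⁻¹ * (d / 2) = 1 / 2 := by field_simp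
    rw [h5] at h4
    linarith
  calc _ ≤ d⁻¹ * ‖N - Q‖ * ‖resolvent Q w‖ := h1
    _ ≤ d⁻¹ * ‖N - Q‖ * (2 * d⁻¹) := by gcongr
    _ = _ := by
      field_simp

lemma IsNilpotent.notMem_spectrum {Q : A} (hQ : IsNilpotent Q) {w : ℂ} (hw : w ≠ 0) :
    w ∉ spectrum ℂ Q := by
  rw [spectrum.notMem_iff]
  have hu : IsUnit (algebraMap ℂ A w) := (IsUnit.mk0 w hw).map _
  have := (hQ.neg).isUnit_add_left_of_commute hu (Algebra.commute_algebraMap_right w (-Q))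
  rwa [← sub_eq_add_neg] at this

lemma resolvent_eq_sum_of_pow_eq_zero {Q : A} {n : ℕ} (hQ : Q ^ n = 0) {w : ℂ} (hw : w ≠ 0) :
    resolvent Q w = ∑ k ∈ Finset.range n, (w ^ (k + 1))⁻¹ • Q ^ k := by
  have h1 : (algebraMap ℂ A w - Q) * ∑ k ∈ Finset.range n, (w ^ (k + 1))⁻¹ • Q ^ k = 1 := by
    have key (m : ℕ) : (algebraMap ℂ A w - Q) * ∑ k ∈ Finset.range m, (w ^ (k + 1))⁻¹ • Q ^ k =
        1 - (w ^ m)⁻¹ • Q ^ m := by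
      induction m with
      | zero => simp
      | succ m ih =>
        have e : w * (w ^ (m + 1))⁻¹ = (w ^ m)⁻¹ := by
          field_simp
          ring
        rw [Finset.sum_range_succ, mul_add, ih, sub_mul, Algebra.algebraMap_eq_smul_one,
          smul_mul_assoc, one_mul, mul_smul_comm, smul_smul, e, ← pow_succ']
        abel
    rw [key, hQ, smul_zero, sub_zero]
  have hunit := spectrum.notMem_iff.mp (IsNilpotent.notMem_spectrum ⟨n, hQ⟩ hw)
  rw [resolvent, ← mul_one (Ring.inverse _), ← h1, ← mul_assoc, Ring.inverse_mul_cancel _ hunit,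
    one_mul]

/-- The Cauchy integral against `dbar f` of the resolvent of a nilpotent element vanishes when `f`
vanishes near `0`. -/
lemma IsNilpotent.integral_dbar_smul_resolvent {Q : A} (hQ : IsNilpotent Q) {f : ℂ → ℂ}
    (hf : ContDiff ℝ 1 f) (hc : HasCompactSupport f) (h0 : (0 : ℂ) ∉ tsupport f) :
    Integrable (fun w => dbar f w • resolvent Q w) ∧ ∫ w, dbar f w • resolvent Q w = 0 := by
  obtain ⟨n, hn⟩ := hQ
  have hmom (k : ℕ) := integral_dbar_mul_inv_pow_eq_zero hf hc h0 k
  simp only [sub_zero] at hmom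
  have e : (fun w => dbar f w • resolvent Q w) =
      fun w => ∑ k ∈ Finset.range n, (dbar f w * (w ^ (k + 1))⁻¹) • Q ^ k := by
    ext w
    by_cases hw : w = 0
    · have : dbar f w = 0 := by
        rw [hw]
        exact image_eq_zero_of_notMem_tsupport fun h => h0 (tsupport_dbar_subset h)
      simp [this]
    · rw [resolvent_eq_sum_of_pow_eq_zero hn hw, Finset.smul_sum]
      simp only [smul_smul]
  have hint (k : ℕ) : Integrable fun w => (dbar f w * (w ^ (k + 1))⁻¹) • Q ^ k :=
    (hmom (k + 1)).1.smul_const _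
  rw [e]
  refine ⟨integrable_finsetSum _ fun k _ => hint k, ?_⟩
  rw [integral_finsetSum _ fun k _ => hint k]
  refine Finset.sum_eq_zero fun k _ => ?_
  rw [integral_smul_const, (hmom (k + 1)).2, zero_smul]

/-- The Cauchy integral of the resolvent of a normal element is given by the functional calculus,
so its norm dominates the scalar Cauchy integrals at the points of the spectrum. -/
lemma IsStarNormal.norm_integral_mul_inv_le {N : A} (hN : IsStarNormal N) {g : ℂ → ℂ}
    (hg : Continuous g) (hgc : HasCompactSupport g) {d : ℝ} (hd : 0 < d)
    (hdist : ∀ w ∈ tsupport g, ∀ z ∈ spectrum ℂ N, d ≤ ‖w - z‖) {z : ℂ} (hz : z ∈ spectrum ℂ N) :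
    Integrable (fun w => g w • resolvent N w) ∧
      ‖∫ w, g w * (w - z)⁻¹‖ ≤ ‖∫ w, g w • resolvent N w‖ := by
  have hgi : Integrable g := hg.integrable_of_hasCompactSupport hgc
  let F : ℂ → ℂ → ℂ := fun w z => g w * (w - z)⁻¹
  have hF : ContinuousOn (Function.uncurry F) (Set.univ ×ˢ spectrum ℂ N) := by
    rintro ⟨w, x⟩ ⟨-, hx⟩
    refine ContinuousAt.continuousWithinAt ?_
    by_cases hw : w ∈ tsupport g
    · have hne : w - x ≠ 0 := norm_pos_iff.mp (hd.trans_le (hdist w hw x hx))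
      exact (hg.comp continuous_fst).continuousAt.mul
        ((continuous_fst.sub continuous_snd).continuousAt.inv₀ hne)
    · have h1 : ∀ᶠ p : ℂ × ℂ in nhds (w, x), g p.1 = 0 :=
        continuousAt_fst.eventually (notMem_tsupport_iff_eventuallyEq.mp hw)
      refine (continuousAt_const (y := (0 : ℂ))).congr ?_
      filter_upwards [h1] with p hp
      simp [Function.uncurry, F, hp]
  have hbound (w x : ℂ) (hx : x ∈ spectrum ℂ N) : ‖F w x‖ ≤ ‖g w‖ * d⁻¹ := by
    by_cases hw : w ∈ tsupport g
    · rw [norm_mul, norm_inv]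
      gcongr
      exact hdist w hw x hx
    · simp [F, image_eq_zero_of_notMem_tsupport hw]
  have hbi : Integrable fun w => ‖g w‖ * d⁻¹ := hgi.norm.mul_const _
  have hcfc (w : ℂ) : cfc (F w) N = g w • resolvent N w := by
    by_cases hw : w ∈ tsupport g
    · have hwN : w ∉ spectrum ℂ N := fun h => by simpa using hd.trans_le (hdist w hw w h)
      have hc : ContinuousOn (fun x => (w - x)⁻¹) (spectrum ℂ N) :=
        (continuousOn_const.sub continuousOn_id).inv₀ fun x hx h => by
          have h' : w = x := sub_eq_zero.mp h
          exact hwN (h' ▸ hx)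
      rw [← hN.cfc_inv_sub_eq_resolvent hwN]
      exact cfc_const_mul (g w) _ N hc
    · simp [F, image_eq_zero_of_notMem_tsupport hw]
  have h1 := integrable_cfc F (fun w => ‖g w‖ * d⁻¹) N hF (.of_forall hbound) hbi.2 hN
  have h2 := cfc_integral (μ := volume) F (fun w => ‖g w‖ * d⁻¹) N hF (.of_forall hbound) hbi.2 hN
  simp only [hcfc] at h1 h2
  refine ⟨h1, ?_⟩
  rw [← h2]
  refine norm_apply_le_norm_cfc (fun r => ∫ w, F w r) N hz ?_ hN
  refine continuousOn_of_dominated (bound := fun w => ‖g w‖ * d⁻¹) (fun x hx => ?_)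
    (fun x hx => .of_forall fun w => hbound w x hx) hbi (.of_forall fun w => ?_)
  · exact (hF.comp_continuous (Continuous.prodMk_left x) fun w => ⟨trivial, hx⟩).aestronglyMeasurable
  · exact hF.comp (Continuous.prodMk_right w).continuousOn fun x hx => ⟨trivial, hx⟩

/-- Quantitative obstruction to approximation by nilpotents: if `f` vanishes near `0` and `dbar f`
is supported away from the spectrum of a normal element, then that element keeps a distance to all
nilpotent elements which depends only on `f`, on a spectral value at which the Cauchy integral of
`dbar f` is nonzero, and on the distance from the support to the spectrum. -/
lemma exists_pos_le_norm_sub_of_isNilpotent {f : ℂ → ℂ} (hf : ContDiff ℝ 1 f)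
    (hc : HasCompactSupport f) (h0 : (0 : ℂ) ∉ tsupport f) {z : ℂ}
    (hz : ∫ w, dbar f w * (w - z)⁻¹ ≠ 0) {d : ℝ} (hd : 0 < d) :
    ∃ δ > 0, ∀ (N Q : A), IsStarNormal N → z ∈ spectrum ℂ N →
      (∀ w ∈ tsupport (dbar f), ∀ x ∈ spectrum ℂ N, d ≤ ‖w - x‖) → IsNilpotent Q →
        δ ≤ ‖N - Q‖ := by
  set c := ‖∫ w, dbar f w * (w - z)⁻¹‖ with hcdef
  have hcpos : 0 < c := norm_pos_iff.mpr hz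
  set G := ∫ w, ‖dbar f w‖ with hG
  have hG0 : 0 ≤ G := integral_nonneg fun w => norm_nonneg _
  have hgi : Integrable (dbar f) := (continuous_dbar hf).integrable_of_hasCompactSupport hc.dbar
  refine ⟨min (d / 2) (c * d ^ 2 / (2 * (G + 1))), by positivity, fun N Q hN hzN hdist hQ => ?_⟩
  by_contra! hlt
  obtain ⟨hlt1, hlt2⟩ := lt_min_iff.mp hlt
  obtain ⟨hi1, hle⟩ := hN.norm_integral_mul_inv_le (continuous_dbar hf) hc.dbar hd hdist hzN
  obtain ⟨hi2, hzero⟩ := hQ.integral_dbar_smul_resolvent hf hc h0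
  have hpt (w : ℂ) : ‖dbar f w • resolvent N w - dbar f w • resolvent Q w‖ ≤
      ‖dbar f w‖ * (2 / d ^ 2 * ‖N - Q‖) := by
    rw [← smul_sub, norm_smul]
    by_cases hw : w ∈ tsupport (dbar f)
    · gcongr
      refine hN.norm_resolvent_sub_resolvent_le hd (hdist w hw) (hQ.notMem_spectrum ?_) hlt1.le
      rintro rfl
      exact h0 (tsupport_dbar_subset hw)
    · simp [image_eq_zero_of_notMem_tsupport hw]
  have h1 : c ≤ G * (2 / d ^ 2 * ‖N - Q‖) := by
    calc c ≤ ‖∫ w, dbar f w • resolvent N w‖ := hle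
      _ = ‖∫ w, (dbar f w • resolvent N w - dbar f w • resolvent Q w)‖ := by
        rw [integral_sub hi1 hi2, hzero, sub_zero]
      _ ≤ ∫ w, ‖dbar f w‖ * (2 / d ^ 2 * ‖N - Q‖) :=
        norm_integral_le_of_norm_le (hgi.norm.mul_const _) (.of_forall hpt)
      _ = _ := integral_mul_const _ _
  rw [lt_div_iff₀ (by positivity)] at hlt2
  have h2 : G * (2 / d ^ 2 * ‖N - Q‖) * d ^ 2 = 2 * G * ‖N - Q‖ := by
    field_simp
  have h3 : c * d ^ 2 ≤ 2 * G * ‖N - Q‖ := by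
    rw [← h2]
    gcongr
  nlinarith [norm_nonneg (N - Q)]

/-- The spectrum of a normal limit of nilpotent elements is connected. A piece not containing `0`
would be detected by a smooth function equal to `1` near that piece and to `0` near the rest. -/
lemma IsStarNormal.isPreconnected_spectrum_of_mem_closure {N : A} (hN : IsStarNormal N)
    (hcl : N ∈ closure {Q : A | IsNilpotent Q}) (h0 : (0 : ℂ) ∈ spectrum ℂ N) :
    IsPreconnected (spectrum ℂ N) := by
  have hcomp : IsCompact (spectrum ℂ N) := spectrum.isCompact N
  rw [isPreconnected_closed_iff]
  -- it suffices to rule out a separation in which the second piece contains `0`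
  have key : ∀ s t : Set ℂ, IsClosed s → IsClosed t → spectrum ℂ N ⊆ s ∪ t →
      (spectrum ℂ N ∩ s).Nonempty → (0 : ℂ) ∈ t → (spectrum ℂ N ∩ (s ∩ t)).Nonempty := by
    intro s t hs ht hst hne h0t
    by_contra hdis
    rw [Set.not_nonempty_iff_eq_empty] at hdis
    obtain ⟨z, hz, hzs⟩ := hne
    set K₁ := spectrum ℂ N ∩ s
    set K₂ := spectrum ℂ N ∩ t
    have hK₁ : IsCompact K₁ := hcomp.inter_right hs
    have hK₂ : IsCompact K₂ := hcomp.inter_right ht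
    have hdisj : Disjoint K₁ K₂ := by
      rw [Set.disjoint_iff_inter_eq_empty, ← hdis]
      ext x
      simp only [K₁, K₂, Set.mem_inter_iff]
      tauto
    obtain ⟨δ, hδ, hδd⟩ := hdisj.exists_cthickenings hK₁ hK₂.isClosed
    obtain ⟨φ, hφ0, hφ1, -⟩ := exists_contMDiffMap_zero_one_of_isClosed (n := 1)
      (modelWithCornersSelf ℝ ℂ) (s := (Metric.thickening δ K₁)ᶜ)
      (t := Metric.cthickening (δ / 2) K₁) Metric.isOpen_thickening.isClosed_compl
      Metric.isClosed_cthickening (by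
        rw [Set.disjoint_compl_left_iff_subset]
        exact Metric.cthickening_subset_thickening' hδ (half_lt_self hδ) _)
    let f : ℂ → ℂ := fun w => (φ w : ℂ)
    have hf : ContDiff ℝ 1 f := Complex.ofRealCLM.contDiff.comp φ.contMDiff.contDiff
    have hsupp : tsupport f ⊆ Metric.cthickening δ K₁ := by
      refine closure_minimal (fun w hw => ?_) Metric.isClosed_cthickening
      refine Metric.thickening_subset_cthickening _ _ ?_
      by_contra h
      exact hw (by simp [f, hφ0 h])
    have hc : HasCompactSupport f :=
      hK₁.cthickening.of_isClosed_subset (isClosed_tsupport _) hsupp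
    have hK₂f (y : ℂ) (hy : y ∈ K₂) : Metric.cthickening δ K₁ ∩ Metric.ball y δ = ∅ := by
      rw [← Set.subset_empty_iff]
      rintro w ⟨hw1, hw2⟩
      exact hδd.le_bot ⟨hw1, Metric.mem_cthickening_of_dist_le w y δ K₂ hy (le_of_lt hw2)⟩
    have h0f : (0 : ℂ) ∉ tsupport f := fun h => by
      have : (0 : ℂ) ∈ Metric.cthickening δ K₁ ∩ Metric.ball 0 δ :=
        ⟨hsupp h, Metric.mem_ball_self hδ⟩
      rw [hK₂f 0 ⟨h0, h0t⟩] at this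
      exact this
    have hone (x : ℂ) (hx : x ∈ K₁) (w : ℂ) (hw : dist w x < δ / 2) : f =ᶠ[nhds w] 1 := by
      have hopen : Metric.ball x (δ / 2) ∈ nhds w := Metric.isOpen_ball.mem_nhds hw
      filter_upwards [hopen] with v hv
      have : φ v = 1 := hφ1 (Metric.mem_cthickening_of_dist_le v x _ _ hx (le_of_lt hv))
      simp [f, this]
    have hdist : ∀ w ∈ tsupport (dbar f), ∀ x ∈ spectrum ℂ N, δ / 2 ≤ ‖w - x‖ := by
      intro w hw x hx
      by_contra! hlt
      rw [← dist_eq_norm] at hlt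
      rcases hst hx with hxs | hxt
      · refine notMem_tsupport_iff_eventuallyEq.mpr ?_ hw
        filter_upwards [(hone x ⟨hx, hxs⟩ w hlt).eventuallyEq_nhds] with v hv
        rw [dbar_congr hv]
        simp [dbar, Pi.one_def]
      · have : w ∈ Metric.cthickening δ K₁ ∩ Metric.ball x δ :=
          ⟨hsupp (tsupport_dbar_subset hw), hlt.trans (half_lt_self hδ)⟩
        rw [hK₂f x ⟨hx, hxt⟩] at this
        exact this
    have hne := integral_dbar_mul_inv_ne_zero hf hc (hone z ⟨hz, hzs⟩ z (by simpa using half_pos hδ))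
    obtain ⟨η, hη, h⟩ := exists_pos_le_norm_sub_of_isNilpotent (A := A) hf hc h0f hne (half_pos hδ)
    obtain ⟨Q, hQ, hNQ⟩ := Metric.mem_closure_iff.mp hcl η hη
    rw [dist_eq_norm] at hNQ
    exact absurd (h N Q hN hz hdist hQ) (not_le.mpr hNQ)
  intro s t hs ht hst hsn htn
  rcases hst h0 with h | h
  · rw [Set.inter_comm s t]
    exact key t s ht hs (by rwa [Set.union_comm]) htn h
  · exact key s t hs ht hst hsn h

/-- If normal elements with spectrum in `[0, 1]` containing `1` are asymptotically nilpotent, then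
their spectra become dense in `[0, 1]`: there is no persistent gap below the spectral value `1`. -/
lemma exists_pos_forall_exists_mem_spectrum {t η : ℝ} (ht : t ∈ Set.Icc (0 : ℝ) 1) (hη : 0 < η) :
    ∃ δ > 0, ∀ H Q : A, IsStarNormal H → (1 : ℂ) ∈ spectrum ℂ H →
      (∀ z ∈ spectrum ℂ H, ∃ s ∈ Set.Icc (0 : ℝ) 1, z = s) → IsNilpotent Q → ‖H - Q‖ < δ →
        ∃ s : ℝ, (s : ℂ) ∈ spectrum ℂ H ∧ |s - t| < η := by
  obtain ⟨a, b, ha, hab, hb, hat, hbt⟩ : ∃ a b : ℝ, 0 < a ∧ a < b ∧ b < 1 ∧ t - η < a ∧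
      b < t + η := by
    have h1 : max 0 (t - η) < min 1 (t + η) := by
      rcases ht with ⟨h0, h1⟩
      simp only [max_lt_iff, lt_min_iff]
      refine ⟨⟨?_, ?_⟩, ?_, ?_⟩ <;> linarith
    obtain ⟨a, ha1, ha2⟩ := exists_between h1
    obtain ⟨b, hb1, hb2⟩ := exists_between ha2
    simp only [max_lt_iff, lt_min_iff] at *
    exact ⟨a, b, ha1.1, hb1, hb2.1, ha1.2, hb2.2⟩
  -- a cutoff about `1` whose annulus of variation meets `[0, 1]` well inside `[a, b]`
  set d := (b - a) / 3 with hd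
  have hd0 : 0 < d := by rw [hd]; linarith
  have hr : 0 < 1 - b + d := by linarith
  have hrR : 1 - b + d < 1 - a - d := by rw [hd]; linarith
  obtain ⟨δ, hδ, h⟩ := exists_pos_le_norm_sub_of_isNilpotent (A := A)
    (f := radialCutoff 1 (1 - b + d) (1 - a - d)) contDiff_radialCutoff
    (hasCompactSupport_radialCutoff hr.le hrR)
    (fun h0 => by
      have := tsupport_radialCutoff_subset hr.le hrR h0
      rw [Metric.mem_closedBall, dist_eq_norm] at this
      norm_num at this
      linarith)
    (integral_dbar_radialCutoff_ne_zero hr hrR) hd0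
  refine ⟨δ, hδ, fun H Q hH h1 hspec hQ hlt => ?_⟩
  by_contra! hgap
  refine absurd (h H Q hH h1 (fun w hw x hx => ?_) hQ) (not_le.mpr hlt)
  obtain ⟨s, hs, rfl⟩ := hspec x hx
  have hs' : s ≤ a ∨ b ≤ s := by
    by_contra! hc
    have := hgap s hx
    rw [le_abs] at this
    rcases this with h | h <;> linarith
  have hann : tsupport (dbar (radialCutoff 1 (1 - b + d) (1 - a - d))) ⊆
      {w : ℂ | 1 - b + d ≤ ‖w - 1‖ ∧ ‖w - 1‖ ≤ 1 - a - d} := by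
    refine closure_minimal (fun w hw => ?_) ?_
    · by_contra hc
      rw [Set.mem_ofPred_eq, not_and_or, not_le, not_le] at hc
      exact hw (dbar_radialCutoff_eq_zero hr.le hrR hc)
    · have hcont : Continuous fun w : ℂ => ‖w - 1‖ := by fun_prop
      exact (isClosed_le continuous_const hcont).inter (isClosed_le hcont continuous_const)
  obtain ⟨hw1, hw2⟩ := hann hw
  have hnorm : ‖(s : ℂ) - 1‖ = 1 - s := by
    rw [← Complex.ofReal_one, ← Complex.ofReal_sub, Complex.norm_real, Real.norm_eq_abs,
      abs_sub_comm, abs_of_nonneg (by linarith [hs.2])]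
  have e1 : ‖w - 1‖ ≤ ‖w - s‖ + ‖(s : ℂ) - 1‖ := norm_sub_le_norm_sub_add_norm_sub _ _ _
  have e2 : ‖(s : ℂ) - 1‖ ≤ ‖w - s‖ + ‖w - 1‖ := by
    rw [norm_sub_rev w s]
    exact norm_sub_le_norm_sub_add_norm_sub _ _ _
  rcases hs' with hs' | hs' <;> linarith

end NilpotentApproximation

/-! ### Limits of nilpotent elements: spectrum and identity component -/

section Forward

variable {A : Type*} [CStarAlgebra A]

lemma zero_mem_spectrum_of_mem_closure_isNilpotent [Nontrivial A] {N : A}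
    (hcl : N ∈ closure {Q : A | IsNilpotent Q}) : (0 : ℂ) ∈ spectrum ℂ N := by
  rw [spectrum.zero_mem_iff]
  intro hu
  obtain ⟨Q, hQu, hQ⟩ := mem_closure_iff.mp hcl {x | IsUnit x} Units.isOpen hu
  exact hQ.not_isUnit hQu

/-- For a nilpotent `Q` all invertible elements of the form `z - t Q` form a connected family,
which contains `1`. -/
lemma IsNilpotent.algebraMap_sub_mem_identityComponent {Q : A} (hQ : IsNilpotent Q) {z : ℂ}
    (hz : z ≠ 0) : algebraMap ℂ A z - Q ∈ identityComponent A := by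
  have hunit (p : ({0}ᶜ : Set ℂ) × ℂ) : IsUnit (algebraMap ℂ A p.1 - p.2 • Q) :=
    spectrum.notMem_iff.mp ((hQ.smul p.2).notMem_spectrum p.1.2)
  let F : ({0}ᶜ : Set ℂ) × ℂ → Aˣ := fun p => (hunit p).unit
  have hF : Continuous F := by
    rw [Units.isOpenEmbedding_val.isInducing.continuous_iff]
    have : (Units.val ∘ F) = fun p => algebraMap ℂ A p.1 - p.2 • Q := by
      ext p
      simp [F]
    rw [this]
    have := continuous_algebraMap ℂ A
    fun_prop
  have : ConnectedSpace ({0}ᶜ : Set ℂ) := isConnected_iff_connectedSpace.mp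
    (isConnected_compl_singleton_of_one_lt_rank (by simp) 0)
  have hconn : IsPreconnected (Set.range F) := isPreconnected_range hF
  have h1 : (1 : Aˣ) ∈ Set.range F := ⟨(⟨1, by simp⟩, 0), by ext; simp [F]⟩
  exact ⟨F (⟨z, hz⟩, 1), hconn.subset_connectedComponent h1 ⟨_, rfl⟩, by simp [F]⟩

lemma algebraMap_sub_mem_identityComponent_of_mem_closure [Nontrivial A] {N : A}
    (hcl : N ∈ closure {Q : A | IsNilpotent Q}) {z : ℂ} (hz : z ∉ spectrum ℂ N) :
    algebraMap ℂ A z - N ∈ identityComponent A := by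
  have hz0 : z ≠ 0 := by
    rintro rfl
    exact hz (zero_mem_spectrum_of_mem_closure_isNilpotent hcl)
  obtain ⟨u, hu⟩ := spectrum.notMem_iff.mp hz
  refine ⟨u, ?_, hu⟩
  rw [← (isClosed_connectedComponent (x := (1 : Aˣ))).closure_eq,
    Units.isOpenEmbedding_val.isInducing.closure_eq_preimage_closure_image, Set.mem_preimage, hu]
  have hcont : Continuous fun x : A => algebraMap ℂ A z - x := by fun_prop
  refine closure_mono ?_ (image_closure_subset_closure_image hcont ⟨N, hcl, rfl⟩)
  rintro _ ⟨Q, hQ, rfl⟩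
  exact IsNilpotent.algebraMap_sub_mem_identityComponent hQ hz0

end Forward

/-! ### Polynomial curves through a connected compact set -/

section Curves

open Polynomial

/-- A connected compact set containing `0` is, up to `ε`, traced by a polynomial curve that starts
at `0`. -/
lemma exists_polynomial_curve_near {K : Set ℂ} (hK : IsCompact K) (hconn : IsConnected K)
    (h0 : (0 : ℂ) ∈ K) {ε : ℝ} (hε : 0 < ε) :
    ∃ (p : ℂ[X]) (T : Set ℝ), p.eval 0 = 0 ∧ T.Finite ∧ T ⊆ Set.Icc 0 1 ∧
      (∀ t ∈ Set.Icc (0 : ℝ) 1, ∃ k ∈ K, ‖p.eval (t : ℂ) - k‖ < ε) ∧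
      (∀ k ∈ K, ∃ t ∈ T, ‖p.eval (t : ℂ) - k‖ < ε) := by
  have hε2 : 0 < ε / 2 := half_pos hε
  have hpath : IsPathConnected (Metric.thickening (ε / 2) K) := by
    refine Metric.isOpen_thickening.isConnected_iff_isPathConnected.mp ?_
    have : Metric.thickening (ε / 2) K =
        (fun q : ℂ × ℂ => q.1 + q.2) '' (K ×ˢ Metric.ball 0 (ε / 2)) := by
      ext x
      simp only [Metric.mem_thickening_iff, Set.mem_image, Set.mem_prod, mem_ball_zero_iff]
      constructor
      · rintro ⟨k, hk, hx⟩
        exact ⟨(k, x - k), ⟨hk, by rwa [← dist_eq_norm]⟩, by simp⟩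
      · rintro ⟨⟨k, v⟩, ⟨hk, hv⟩, rfl⟩
        exact ⟨k, hk, by simpa [dist_eq_norm] using hv⟩
    rw [this]
    exact (hconn.prod (Metric.isConnected_ball hε2)).image _ (by fun_prop)
  obtain ⟨net, hnetK, hnetfin, hnet⟩ := hK.finite_cover_balls hε2
  have := hnetfin.fintype
  let e := Fintype.equivFin net
  let x : Fin (Fintype.card net + 1) → ℂ := Fin.cons 0 fun i => (e.symm i : ℂ)
  have hx : ∀ i, x i ∈ Metric.thickening (ε / 2) K := by
    intro i
    refine Metric.self_subset_thickening hε2 K ?_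
    refine Fin.cases ?_ (fun j => ?_) i
    · simpa [x] using h0
    · simpa [x] using hnetK (e.symm j).2
  obtain ⟨γ, hγU, hγx⟩ := hpath.exists_path_through_family x hx
  let g : ℝ → ℂ := γ.extend
  have hg : Continuous g := γ.continuous_extend
  have hg0 : g 0 = 0 := by simp [g, x]
  obtain ⟨a, ha⟩ := exists_polynomial_near_of_continuousOn 0 1 (fun t => (g t).re)
    (by fun_prop) (ε / 8) (by positivity)
  obtain ⟨b, hb⟩ := exists_polynomial_near_of_continuousOn 0 1 (fun t => (g t).im)
    (by fun_prop) (ε / 8) (by positivity)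
  let q : ℂ[X] := a.map (algebraMap ℝ ℂ) + C Complex.I * b.map (algebraMap ℝ ℂ)
  have hq (t : ℝ) : q.eval (t : ℂ) = (a.eval t : ℝ) + Complex.I * (b.eval t : ℝ) := by
    have h (c : ℝ[X]) : (c.map (algebraMap ℝ ℂ)).eval (t : ℂ) = (c.eval t : ℝ) := by
      rw [eval_map_algebraMap]
      exact aeval_algebraMap_apply_eq_algebraMap_eval t c
    simp [q, h]
  have hqg (t : ℝ) (ht : t ∈ Set.Icc (0 : ℝ) 1) : ‖q.eval (t : ℂ) - g t‖ ≤ ε / 4 := by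
    refine (Complex.norm_le_abs_re_add_abs_im _).trans ?_
    have h1 := ha t ht
    have h2 := hb t ht
    rw [hq]
    simp only [Complex.sub_re, Complex.sub_im, Complex.add_re, Complex.add_im, Complex.ofReal_re,
      Complex.ofReal_im, Complex.mul_re, Complex.mul_im, Complex.I_re, Complex.I_im]
    simp only [zero_mul, one_mul, sub_zero, add_zero, zero_add]
    linarith
  let p : ℂ[X] := q - C (q.eval 0)
  have hpg (t : ℝ) (ht : t ∈ Set.Icc (0 : ℝ) 1) : ‖p.eval (t : ℂ) - g t‖ ≤ ε / 2 := by
    have h1 := hqg t ht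
    have h2 := hqg 0 (by simp)
    rw [hg0, sub_zero, Complex.ofReal_zero] at h2
    have e : p.eval (t : ℂ) - g t = (q.eval (t : ℂ) - g t) - q.eval 0 := by
      simp only [p, eval_sub, eval_C]
      ring
    rw [e]
    refine (norm_sub_le _ _).trans ?_
    linarith
  -- a parameter for each point of the net
  have hτ (y : net) : ∃ t ∈ Set.Icc (0 : ℝ) 1, g t = y := by
    obtain ⟨t, ht⟩ := hγx (e y).succ
    refine ⟨t, t.2, ?_⟩
    simp only [g, Path.extend_apply γ t.2, Subtype.coe_eta, ht]
    simp [x]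
  choose τ hτI hτg using hτ
  refine ⟨p, Set.range τ, by simp [p], Set.finite_range τ, ?_, fun t ht => ?_, fun k hk => ?_⟩
  · rintro _ ⟨y, rfl⟩
    exact hτI y
  · have hgt : g t ∈ Metric.thickening (ε / 2) K := by
      refine hγU ?_
      simp only [g, Path.extend_apply γ ht]
      exact ⟨_, rfl⟩
    obtain ⟨k, hk, hkd⟩ := Metric.mem_thickening_iff.mp hgt
    refine ⟨k, hk, ?_⟩
    rw [dist_eq_norm] at hkd
    have := norm_sub_le_norm_sub_add_norm_sub (p.eval (t : ℂ)) (g t) k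
    linarith [hpg t ht]
  · obtain ⟨y, hy, hky⟩ := Set.mem_iUnion₂.mp (hnet hk)
    refine ⟨τ ⟨y, hy⟩, ⟨_, rfl⟩, ?_⟩
    have h1 := hpg _ (hτI ⟨y, hy⟩)
    rw [hτg] at h1
    rw [Metric.mem_ball, dist_eq_norm, norm_sub_rev] at hky
    have := norm_sub_le_norm_sub_add_norm_sub (p.eval (τ ⟨y, hy⟩ : ℂ)) y k
    linarith

/-- Polynomials are Lipschitz on bounded sets of a normed algebra. -/
lemma Polynomial.exists_norm_aeval_sub_aeval_le (A : Type*) [NormedRing A] [NormOneClass A]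
    [NormedAlgebra ℂ A] (p : ℂ[X]) :
    ∃ C : ℝ, 0 ≤ C ∧ ∀ a b : A, ‖a‖ ≤ 2 → ‖b‖ ≤ 2 →
      ‖aeval a p - aeval b p‖ ≤ C * ‖a - b‖ := by
  have hpow (n : ℕ) : ∃ C : ℝ, 0 ≤ C ∧ ∀ a b : A, ‖a‖ ≤ 2 → ‖b‖ ≤ 2 →
      ‖a ^ n - b ^ n‖ ≤ C * ‖a - b‖ := by
    induction n with
    | zero => exact ⟨0, le_rfl, fun a b _ _ => by simp⟩
    | succ n ih =>
      obtain ⟨C, hC, h⟩ := ih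
      refine ⟨2 * C + 2 ^ n, by positivity, fun a b ha hb => ?_⟩
      have e : a ^ (n + 1) - b ^ (n + 1) = a * (a ^ n - b ^ n) + (a - b) * b ^ n := by
        rw [pow_succ', pow_succ', mul_sub, sub_mul]
        abel
      have hbn : ‖b ^ n‖ ≤ 2 ^ n := (norm_pow_le b n).trans (by gcongr)
      calc ‖a ^ (n + 1) - b ^ (n + 1)‖ ≤ ‖a‖ * ‖a ^ n - b ^ n‖ + ‖a - b‖ * ‖b ^ n‖ := by
            rw [e]
            exact (norm_add_le _ _).trans (add_le_add (norm_mul_le _ _) (norm_mul_le _ _))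
        _ ≤ 2 * (C * ‖a - b‖) + ‖a - b‖ * 2 ^ n := by
            gcongr
            exact h a b ha hb
        _ = _ := by ring
  induction p using Polynomial.induction_on' with
  | add p q hp hq =>
    obtain ⟨C, hC, h⟩ := hp
    obtain ⟨D, hD, h'⟩ := hq
    refine ⟨C + D, by positivity, fun a b ha hb => ?_⟩
    have e : aeval a (p + q) - aeval b (p + q) =
        (aeval a p - aeval b p) + (aeval a q - aeval b q) := by
      simp only [map_add]
      abel
    rw [e, add_mul]
    exact (norm_add_le _ _).trans (add_le_add (h a b ha hb) (h' a b ha hb))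
  | monomial n c =>
    obtain ⟨C, hC, h⟩ := hpow n
    refine ⟨‖c‖ * C, by positivity, fun a b ha hb => ?_⟩
    rw [aeval_monomial, aeval_monomial, ← Algebra.smul_def, ← Algebra.smul_def, ← smul_sub,
      norm_smul, mul_assoc]
    gcongr
    exact h a b ha hb

end Curves

/-! ### Approximation of normal elements by nilpotent elements -/

section Backward

open Polynomial

variable {A : Type*} [CStarAlgebra A]

/-- If the unit is properly infinite and equivalent to all nonzero projections, then it is the sum
of the range projections of two isometries. -/
lemma exists_isometry_pair [Nontrivial A] (hinf : IsProperlyInfinite (1 : A))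
    (heq : ∀ p : A, IsStarProjection p → p ≠ 0 → MurrayVonNeumannEquiv 1 p) :
    ∃ s t : A, star s * s = 1 ∧ star t * t = 1 ∧ s * star s + t * star t = 1 := by
  obtain ⟨-, -, e, f, he, -, -, -, hef, hev, hfv⟩ := hinf
  have hne (p : A) (hp : MurrayVonNeumannEquiv p 1) : p ≠ 0 := by
    rintro rfl
    obtain ⟨v, hv1, hv2⟩ := hp
    rw [CStarRing.star_mul_self_eq_zero_iff] at hv1
    simp [hv1] at hv2
  have he1 : 1 - e ≠ 0 := fun h => by
    rw [← sub_eq_zero.mp h, one_mul] at hef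
    exact hne f hfv hef
  obtain ⟨s, hs1, hs2⟩ := heq e he (hne e hev)
  obtain ⟨t, ht1, ht2⟩ := heq (1 - e) he.one_sub he1
  exact ⟨s, t, hs1, ht1, by rw [hs2, ht2]; abel⟩

lemma IsStarNormal.exists_mem_spectrum_norm_sub_le {N M : A} (hN : IsStarNormal N) {r : ℝ}
    (h : ‖N - M‖ < r) {z : ℂ} (hz : z ∈ spectrum ℂ M) : ∃ x ∈ spectrum ℂ N, ‖z - x‖ ≤ r := by
  by_contra! hfar
  have hr : 0 < r := (norm_nonneg _).trans_lt h
  have hzN : z ∉ spectrum ℂ N := fun h' => by simpa using hr.trans (hfar z h')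
  obtain ⟨u, hu⟩ := spectrum.notMem_iff.mp hzN
  have hR := hN.norm_resolvent_le hr fun x hx => (hfar x hx).le
  rw [resolvent, ← hu, Ring.inverse_unit] at hR
  have : Nontrivial A := by
    by_contra hA
    rw [not_nontrivial_iff_subsingleton] at hA
    simpa using (spectrum.of_subsingleton M).subset hz
  have hpos : 0 < ‖(↑u⁻¹ : A)‖ := Units.norm_pos u⁻¹
  have hlt : ‖N - M‖ < ‖(↑u⁻¹ : A)‖⁻¹ := h.trans_le ((le_inv_comm₀ hr hpos).mpr hR)
  refine spectrum.notMem_iff.mpr ?_ hz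
  refine ⟨u.add (N - M) hlt, ?_⟩
  rw [Units.val_add, hu]
  abel

/-- Arbitrarily close to the nilpotent elements there are normal elements with finite spectrum in
`[0, 1]` that contains `1`. They are squares of self-adjoint matrices in a unital matrix subalgebra;
squaring makes the spectrum nonnegative and turns a spectral value `±1` into `1`. -/
lemma exists_isNilpotent_near_positive [Nontrivial A] {s t : A} (hs : star s * s = 1)
    (ht : star t * t = 1) (hst : s * star s + t * star t = 1) {δ : ℝ} (hδ : 0 < δ) :
    ∃ H Q : A, IsStarNormal H ∧ IsNilpotent Q ∧ (spectrum ℂ H).Finite ∧ (1 : ℂ) ∈ spectrum ℂ H ∧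
      (∀ z ∈ spectrum ℂ H, ∃ s ∈ Set.Icc (0 : ℝ) 1, z = s) ∧ ‖H‖ ≤ 1 ∧ ‖H - Q‖ < δ := by
  set ε := min 1 (δ / 4) with hε
  have hε0 : 0 < ε := by positivity
  obtain ⟨n, hn, Q, H, hQ, hH, hHn, hQH⟩ := exists_isNilpotent_norm_sub_le hε0
  have : Nonempty (Fin n) := ⟨⟨0, hn⟩⟩
  obtain ⟨v, hv⟩ := IsCuntzFamily.exists_of_pair hs ht hst (Fin n)
  set a := hv.matrixHom H with ha
  set b := hv.matrixHom Q with hb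
  have hasa : IsSelfAdjoint a := hH.map hv.matrixHom
  have hbn : IsNilpotent b := hQ.map hv.matrixHom
  have han : ‖a‖ = 1 := by
    rw [ha, hv.norm_matrixHom]
    exact hHn
  have hab : ‖a - b‖ ≤ ε := by
    rw [norm_sub_rev, ha, hb, ← map_sub]
    exact (hv.norm_matrixHom_le _).trans hQH
  have hfin : (spectrum ℂ a).Finite :=
    (Matrix.finite_spectrum H).subset (AlgHom.spectrum_apply_subset hv.matrixHom H)
  have hspec : spectrum ℂ (a ^ 2) = (fun x => x ^ 2) '' spectrum ℂ a :=
    (spectrum.map_pow_of_pos (𝕜 := ℂ) a two_pos)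
  refine ⟨a ^ 2, b ^ 2, (hasa.pow 2).isStarNormal, hbn.pow_of_pos two_ne_zero, ?_, ?_, ?_, ?_, ?_⟩
  · rw [hspec]
    exact hfin.image _
  · rw [hspec]
    obtain ⟨k, hk, hkn⟩ := spectrum.exists_nnnorm_eq_spectralRadius a
    rw [hasa.spectralRadius_eq_nnnorm] at hkn
    have hk1 : ‖k‖ = 1 := by
      rw [← han]
      exact_mod_cast congrArg ENNReal.toReal hkn
    refine ⟨k, hk, ?_⟩
    have hre := hasa.mem_spectrum_eq_re hk
    rw [hre, Complex.norm_real, Real.norm_eq_abs] at hk1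
    change k ^ 2 = 1
    have hsq : k.re ^ 2 = 1 := by rw [← sq_abs, hk1, one_pow]
    rw [hre]
    exact_mod_cast hsq
  · rw [hspec]
    rintro _ ⟨k, hk, rfl⟩
    have hre := hasa.mem_spectrum_eq_re hk
    have hle := spectrum.norm_le_norm_of_mem hk
    rw [han, hre, Complex.norm_real, Real.norm_eq_abs] at hle
    refine ⟨k.re ^ 2, ⟨sq_nonneg _, (sq_le_one_iff_abs_le_one _).mpr hle⟩, ?_⟩
    change k ^ 2 = _
    rw [hre]
    simp
  · refine (norm_pow_le a 2).trans ?_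
    simp [han]
  · have e : a ^ 2 - b ^ 2 = a * (a - b) + (a - b) * b := by noncomm_ring
    have hbnorm : ‖b‖ ≤ 1 + ε := by
      have := norm_le_norm_add_norm_sub' b a
      rw [norm_sub_rev] at this
      linarith
    have h1 : ε ≤ 1 := min_le_left _ _
    have h2 : ε ≤ δ / 4 := min_le_right _ _
    calc ‖a ^ 2 - b ^ 2‖ ≤ ‖a‖ * ‖a - b‖ + ‖a - b‖ * ‖b‖ := by
          rw [e]
          exact (norm_add_le _ _).trans (add_le_add (norm_mul_le _ _) (norm_mul_le _ _))
      _ ≤ 1 * ε + ε * (1 + ε) := by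
          rw [han]
          gcongr
      _ < δ := by nlinarith

lemma IsNilpotent.aeval_of_eval_zero {Q : A} (hQ : IsNilpotent Q) {p : ℂ[X]}
    (hp : p.eval 0 = 0) : IsNilpotent (aeval Q p) := by
  obtain ⟨q, rfl⟩ := X_dvd_iff.mpr (coeff_zero_eq_eval_zero p ▸ hp)
  rw [map_mul, aeval_X]
  have hcomm : Commute Q (aeval Q q) := by
    simpa using (Commute.all (X : ℂ[X]) q).map (aeval Q)
  exact hcomm.isNilpotent_mul_right hQ

lemma IsNilpotent.unitary_conj {Q u : A} (hQ : IsNilpotent Q) (hu : star u * u = 1) :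
    IsNilpotent (u * Q * star u) := by
  have key (n : ℕ) : (u * Q * star u) ^ (n + 1) = u * Q ^ (n + 1) * star u := by
    induction n with
    | zero => simp
    | succ n ih =>
      rw [_root_.pow_succ, ih, _root_.pow_succ Q (n + 1)]
      have : u * Q ^ (n + 1) * star u * (u * Q * star u) =
          u * Q ^ (n + 1) * (star u * u) * Q * star u := by noncomm_ring
      rw [this, hu, mul_one, mul_assoc u]
  obtain ⟨n, hn⟩ := hQ
  exact ⟨n + 1, by rw [key, _root_.pow_succ, hn]; simp⟩

lemma norm_unitary_conj_le [Nontrivial A] {u : A} (hu : star u * u = 1) (x : A) :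
    ‖u * x * star u‖ ≤ ‖x‖ := by
  have h1 : ‖u‖ = 1 := by
    have := CStarRing.norm_star_mul_self (x := u)
    rw [hu, norm_one] at this
    nlinarith [norm_nonneg u]
  calc ‖u * x * star u‖ ≤ ‖u‖ * ‖x‖ * ‖star u‖ :=
        (norm_mul_le _ _).trans (by gcongr; exact norm_mul_le _ _)
    _ = ‖x‖ := by rw [norm_star, h1, one_mul, mul_one]

/-- The approximation half of the theorem: a polynomial curve through the spectrum, applied to a
positive element with `ε`-dense spectrum in `[0, 1]`, gives a normal element close to a nilpotent,
and up to unitary conjugation this normal element is close to `N`. -/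
lemma IsStarNormal.mem_closure_isNilpotent [Nontrivial A] {s t : A} (hs : star s * s = 1)
    (ht : star t * t = 1) (hst : s * star s + t * star t = 1)
    (heq : ∀ p : A, IsStarProjection p → p ≠ 0 → MurrayVonNeumannEquiv 1 p) {N : A}
    (hN : IsStarNormal N) (hNcl : N ∈ closure {M : A | IsStarNormal M ∧ (spectrum ℂ M).Finite})
    (h0 : (0 : ℂ) ∈ spectrum ℂ N) (hconn : IsConnected (spectrum ℂ N)) :
    N ∈ closure {Q : A | IsNilpotent Q} := by
  rw [Metric.mem_closure_iff]
  intro ε' hε'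
  set ε := ε' / 6 with hε
  have hε0 : 0 < ε := by positivity
  obtain ⟨M, ⟨hM, hMfin⟩, hNM⟩ := Metric.mem_closure_iff.mp hNcl ε hε0
  rw [dist_eq_norm] at hNM
  obtain ⟨p, T, hp0, hTfin, hTI, hpK, hKp⟩ :=
    exists_polynomial_curve_near (spectrum.isCompact N) hconn h0 hε0
  obtain ⟨C, hC, hLip⟩ := Polynomial.exists_norm_aeval_sub_aeval_le A p
  -- closeness of `H` to nilpotents that forces spectral values of `H` near all points of `T`
  have hη (τ : T) : ∃ δ > 0, ∀ H Q : A, IsStarNormal H → (1 : ℂ) ∈ spectrum ℂ H →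
      (∀ z ∈ spectrum ℂ H, ∃ s ∈ Set.Icc (0 : ℝ) 1, z = s) → IsNilpotent Q → ‖H - Q‖ < δ →
        ∃ s : ℝ, (s : ℂ) ∈ spectrum ℂ H ∧ ‖p.eval (s : ℂ) - p.eval (τ : ℂ)‖ < ε := by
    have hcont : Continuous fun s : ℝ => p.eval (s : ℂ) := p.continuous.comp Complex.continuous_ofReal
    obtain ⟨η, hη, hηp⟩ := Metric.continuous_iff.mp hcont τ ε hε0
    obtain ⟨δ, hδ, h⟩ := exists_pos_forall_exists_mem_spectrum (A := A) (hTI τ.2) hη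
    refine ⟨δ, hδ, fun H Q h1 h2 h3 h4 h5 => ?_⟩
    obtain ⟨s, hs, hsτ⟩ := h H Q h1 h2 h3 h4 h5
    refine ⟨s, hs, ?_⟩
    rw [← dist_eq_norm]
    exact hηp s (by rwa [Real.dist_eq])
  choose δ hδ hdense using hη
  have : Finite T := hTfin
  obtain ⟨δ₀, hδ₀, hδ₀1, hδ₀C, hδ₀T⟩ :
      ∃ δ₀ : ℝ, 0 < δ₀ ∧ δ₀ < 1 ∧ δ₀ < ε / (C + 1) ∧ ∀ τ, δ₀ < δ τ := by
    have h1 : ∀ᶠ x in nhdsWithin (0 : ℝ) (Set.Ioi 0), ∀ τ, x < δ τ :=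
      Filter.eventually_all.mpr fun τ => nhdsWithin_le_nhds (gt_mem_nhds (hδ τ))
    have h2 : ∀ᶠ x in nhdsWithin (0 : ℝ) (Set.Ioi 0), x < 1 :=
      nhdsWithin_le_nhds (gt_mem_nhds one_pos)
    have h3 : ∀ᶠ x in nhdsWithin (0 : ℝ) (Set.Ioi 0), x < ε / (C + 1) :=
      nhdsWithin_le_nhds (gt_mem_nhds (by positivity))
    obtain ⟨x, hx, hx1, hx2, hx3⟩ :=
      ((eventually_mem_nhdsWithin (a := (0 : ℝ)) (s := Set.Ioi 0)).and (h2.and (h3.and h1))).exists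
    exact ⟨x, hx, hx1, hx2, hx3⟩
  obtain ⟨H, Q, hH, hQ, hHfin, hH1, hHI, hHn, hHQ⟩ :=
    exists_isNilpotent_near_positive hs ht hst hδ₀
  have hLcfc : cfc (fun z => p.eval z) H = aeval H p := cfc_polynomial p H
  have hLspec : spectrum ℂ (aeval H p) = (fun z => p.eval z) '' spectrum ℂ H := by
    rw [← hLcfc]
    exact cfc_map_spectrum _ H hH p.continuous.continuousOn
  have hL : IsStarNormal (aeval H p) := by
    rw [← hLcfc]
    exact cfc_predicate _ H
  obtain ⟨u, hu1, -, hu⟩ := hM.exists_unitary_norm_sub_le heq hs ht hst hL hMfin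
    (by rw [hLspec]; exact hHfin.image _) (r := 3 * ε) (by positivity)
    (by
      intro x hx
      obtain ⟨k, hk, hkx⟩ := hN.exists_mem_spectrum_norm_sub_le hNM hx
      obtain ⟨τ, hτ, hτk⟩ := hKp k hk
      obtain ⟨σ, hσ, hστ⟩ := hdense ⟨τ, hτ⟩ H Q hH hH1 hHI hQ (hHQ.trans (hδ₀T _))
      refine ⟨p.eval (σ : ℂ), by rw [hLspec]; exact ⟨_, hσ, rfl⟩, ?_⟩
      have e1 := norm_sub_le_norm_sub_add_norm_sub x k (p.eval (σ : ℂ))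
      have e2 := norm_sub_le_norm_sub_add_norm_sub (p.eval (σ : ℂ)) (p.eval (τ : ℂ)) k
      rw [norm_sub_rev k] at e1
      linarith)
    (by
      intro y hy
      rw [hLspec] at hy
      obtain ⟨z, hz, rfl⟩ := hy
      obtain ⟨σ, hσ, rfl⟩ := hHI z hz
      obtain ⟨k, hk, hkσ⟩ := hpK σ hσ
      rw [norm_sub_rev] at hNM
      obtain ⟨x, hx, hxk⟩ := hM.exists_mem_spectrum_norm_sub_le hNM hk
      refine ⟨x, hx, ?_⟩
      have e1 := norm_sub_le_norm_sub_add_norm_sub (p.eval (σ : ℂ)) k x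
      change ‖x - p.eval (σ : ℂ)‖ ≤ _
      rw [norm_sub_rev]
      linarith)
  refine ⟨u * aeval Q p * star u, (hQ.aeval_of_eval_zero hp0).unitary_conj hu1, ?_⟩
  have hQn : ‖Q‖ ≤ 2 := by
    have := norm_le_norm_add_norm_sub' Q H
    rw [norm_sub_rev] at this
    linarith
  have h1 : ‖aeval H p - aeval Q p‖ ≤ ε := by
    refine (hLip H Q (by linarith) hQn).trans ?_
    have h2 : ‖H - Q‖ ≤ ε / (C + 1) := (hHQ.trans hδ₀C).le
    calc C * ‖H - Q‖ ≤ (C + 1) * (ε / (C + 1)) := by gcongr; linarith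
      _ = ε := by field_simp
  have h2 : ‖u * aeval H p * star u - u * aeval Q p * star u‖ ≤ ε := by
    rw [← sub_mul, ← mul_sub]
    exact (norm_unitary_conj_le hu1 _).trans h1
  rw [dist_eq_norm]
  have e1 := norm_sub_le_norm_sub_add_norm_sub N M (u * aeval Q p * star u)
  have e2 := norm_sub_le_norm_sub_add_norm_sub M (u * aeval H p * star u)
    (u * aeval Q p * star u)
  linarith

end Backward

theorem corollary4p10 {A : Type*} [CStarAlgebra A] [Nontrivial A]
    [TopologicalSpace.SeparableSpace A]
    (hFN : WeakFN A)
    (hinf : ∀ p : A, IsStarProjection p → p ≠ 0 → IsProperlyInfinite p)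
    (heq : ∀ p q : A, IsStarProjection p → p ≠ 0 → IsStarProjection q → q ≠ 0 →
      MurrayVonNeumannEquiv p q)
    (N : A) (hN : IsStarNormal N) :
    N ∈ closure {Q : A | IsNilpotent Q} ↔
      (0 : ℂ) ∈ spectrum ℂ N ∧ IsConnected (spectrum ℂ N) ∧
        ∀ z : ℂ, z ∉ spectrum ℂ N → algebraMap ℂ A z - N ∈ identityComponent A := by
  have heq1 (p : A) (hp : IsStarProjection p) (hp0 : p ≠ 0) : MurrayVonNeumannEquiv 1 p :=
    heq 1 p (.one A) one_ne_zero hp hp0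
  constructor
  · intro hcl
    have h0 := zero_mem_spectrum_of_mem_closure_isNilpotent hcl
    exact ⟨h0, ⟨⟨0, h0⟩, hN.isPreconnected_spectrum_of_mem_closure hcl h0⟩,
      fun z hz => algebraMap_sub_mem_identityComponent_of_mem_closure hcl hz⟩
  · rintro ⟨h0, hconn, hcomp⟩
    obtain ⟨s, t, hs, ht, hst⟩ := exists_isometry_pair (hinf 1 (.one A) one_ne_zero) heq1
    exact hN.mem_closure_isNilpotent hs ht hst heq1 (hFN N hN hcomp) h0 hconn
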